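/- For $b>0$ and $1\le p\le\infty$ let $PW_b^p$ be the space of $f\in L^p(\mathbb R)$ whose Fourier transform $\hat f(\xi)=\int f(x)e^{-2\pi i x\xi}\,dx$, in the sense of tempered distributions, is supported in $[-\tfrac b2,\tfrac b2]$ (each such $f$ is identified with its continuous representative), and let $PW_b^+$ be the space of entire functions $f$ with $$\limsup_{r\to\infty}\int_{|z|=r}\left|z^{-2}e^{-\pi b|\mathrm{Im}(z)|}f(z)\right||dz|<\infty .$$ Let $\psi=\Gamma'/\Gamma$ be the digamma function, and let $G_1(z)=\sin(\pi z)\psi(-z)$, where the removable singularities at $z=0,1,2,\dots$ are filled in by their limits. Put $a_k=0$ for integers $k<0$ and $a_k=(-1)^k\pi$ for integers $k\ge0$. Then: 1. $G_1\in PW_1^+$, while the restriction of $G_1$ to $\mathbb R$ is not in $PW_1^\infty$. 2. $G_1(k)=a_k$ for all $k\in\mathbb Z$. 3. Let $S(z)=\sin(\pi z)/\pi$. For every $\tilde x\in\mathbb R\setminus\mathbb Z$ and $\tilde a\in\mathbb C$ the bandlimited interpolation $$f(z)=\tilde a\frac{S(z)}{S(\tilde x)}+\sum_{k=-\infty}^{\infty}a_k\lim_{z_0\to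 z}\frac{S(z_0)}{S'(k)}\left(\frac1{z_0-k}-\frac1{\tilde x-k}\right)$$ converges uniformly on compact subsets of $\mathbb C$ and is of the form $f(z)=G_1(z)+c\sin(\pi z)$ for a constant $c\in\mathbb C$. 4. There is no $f\in PW_1^\infty$ with $f(k)=a_k$ for all $k\in\mathbb Z$. 5. There are constants $C>0$ and $r_0$ such that $\frac1r\int_{-r}^{0}|G_1(t)|\,dt\ge C\log r$ for all $r\ge r_0$; in particular $\sup_{r>0}\frac1{2r}\int_{-r}^{r}|G_1(t)|\,dt=\infty$. -/

import Mathlib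

open MeasureTheory Filter Topology
open scoped ENNReal FourierTransform SchwartzMap

noncomputable section

/-- The Paley–Wiener space `PW_b^p`: the classes `f ∈ L^p(ℝ)` whose Fourier transform
`∫ f(x) e^{-2πixξ} dx`, taken in the sense of tempered distributions, is supported
in `[-b/2, b/2]`. -/
def PaleyWiener (b : ℝ) (p : ℝ≥0∞) [Fact (1 ≤ p)] : Set (Lp ℂ p (volume : Measure ℝ)) :=
  {f | Distribution.dsupport (𝓕 (Lp.toTemperedDistribution f : 𝓢'(ℝ, ℂ)) : 𝓢'(ℝ, ℂ)) ⊆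
    Set.Icc (-(b / 2)) (b / 2)}

/-- The space `PW_b^+`: the entire functions `f` with
`limsup_{r → ∞} ∫_{|z| = r} |z⁻² e^{-πb|Im z|} f(z)| |dz| < ∞`. The circle is parametrized by
`z = r e^{iθ}`, `0 < θ ≤ 2π`, and `|dz| = r dθ`. -/
def PaleyWienerPlus (b : ℝ) : Set (ℂ → ℂ) :=
  {f | Differentiable ℂ f ∧
    limsup (fun r : ℝ => ∫⁻ θ in Set.Ioc 0 (2 * Real.pi),
      ‖(circleMap 0 r θ) ^ (-2 : ℤ) *
        (Real.exp (-(Real.pi * b * |(circleMap 0 r θ).im|)) : ℂ) *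
          f (circleMap 0 r θ)‖ₑ * ENNReal.ofReal r) atTop < ⊤}

/-- `G₁(z) = sin(πz) ψ(-z)`, the removable singularities at the poles of `ψ(-z)`
being filled in by limits. -/
def G₁ (z : ℂ) : ℂ :=
  limUnder (𝓝[≠] z) fun w : ℂ => Complex.sin (Real.pi * w) * Complex.digamma (-w)

/-- The samples `a_k = 0` for `k < 0` and `a_k = (-1)^k π` for `k ≥ 0`. -/
def stepSamples (k : ℤ) : ℂ := if k < 0 then 0 else (-1) ^ k * (Real.pi : ℂ)

/-- The generating function `S(z) = sin(πz)/π` of the sequence of the integers. -/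
def intGenFun (z : ℂ) : ℂ := Complex.sin (Real.pi * z) / Real.pi

/-- The function `z ↦ lim_{z₀ → z} S(z₀)/S'(k) · (1/(z₀ - k) - 1/(x - k))`. -/
def interpKernel (x : ℝ) (k : ℤ) (z : ℂ) : ℂ :=
  limUnder (𝓝[≠] z) fun w : ℂ =>
    intGenFun w / deriv intGenFun (k : ℂ) * (1 / (w - k) - 1 / ((x : ℂ) - k))

/-- `f` is the bandlimited interpolation of the data `a` on `ℤ` and `a'` at the extra point `x`:
`f(z) = a' S(z)/S(x) + ∑_k a_k lim_{z₀ → z} S(z₀)/S'(k) (1/(z₀ - k) - 1/(x - k))`,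
with uniform convergence on compact subsets of `ℂ`. -/
def IsBandlimitedInterp (a : ℤ → ℂ) (x : ℝ) (a' : ℂ) (f : ℂ → ℂ) : Prop :=
  HasSumLocallyUniformly (fun (k : ℤ) (z : ℂ) => a k * interpKernel x k z)
    (fun z => f z - a' * (intGenFun z / intGenFun x))

end

noncomputable section

/-! ### The sine function on the complex plane -/

/-! The function `G₁` is the interpolation series of the step samples with base point `-1`, plus a
multiple of `sin(πz)`: since `ψ(-z) = -γ + ∑_{k≥0} (1/(z-k) + 1/(k+1))`, multiplying by `sin(πz)`
gives the entire function `sinDigamma`. Its values on `ℤ` can be read off termwise, and changing the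
base point only adds a multiple of `sin(πz)`. The identification with digamma
(`sinDigamma_eq_sin_mul_digamma`) comes from log-convexity of Gamma on a real interval and the
identity theorem.

For growth, the series gives a linear bound times `e^{π|Im z|}` in `Re z ≤ -1`, and the digamma
recurrence carries it to the right (`exists_norm_sinDigamma_le`). On the negative axis the same
series is at least of logarithmic size, hence the averages.

That no bounded `g` with spectrum in `[-1/2, 1/2]` has these samples reflects the unboundedness of
the one-sided frequency projection on `L^∞`. For `q` smooth and supported inside `(0, 1)`, Poisson
summation gives `∑ (-1)^k 𝓕q(k) g(k) = ∫ e^{iπx} 𝓕q g` (`hasSum_alternating_sampling`). For step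
samples the left side is `π ∑_{k≥0} 𝓕q(k) = π ∫ q(v)/(1 - e^{-2πiv}) dv`
(`tendsto_sum_fourier_nat`), whose imaginary part is of order `log(1/δ)` when `q` is 1 on `[δ/4,
1/8]`. On the right side, a piece on the negative half-line may be added to `q` for free, since
after modulation it leaves the spectrum of `g`; the completed profile is a difference of two dilates
of one bump, so its Fourier transform is bounded in `L¹` uniformly in `δ`
(`integral_norm_fourier_bandPass_le`). Letting `δ → 0` is a contradiction. -/

lemma norm_sin_le_exp_abs_im (z : ℂ) : ‖Complex.sin z‖ ≤ Real.exp |z.im| := by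
  have h1 : ‖Complex.exp (-z * Complex.I)‖ ≤ Real.exp |z.im| := by
    rw [Complex.norm_exp]
    exact Real.exp_le_exp.2 (by simpa using le_abs_self z.im)
  have h2 : ‖Complex.exp (z * Complex.I)‖ ≤ Real.exp |z.im| := by
    rw [Complex.norm_exp]
    exact Real.exp_le_exp.2 (by simpa using neg_le_abs z.im)
  rw [Complex.sin, norm_div, norm_mul, Complex.norm_I, Complex.norm_ofNat]
  linarith [norm_sub_le (Complex.exp (-z * Complex.I)) (Complex.exp (z * Complex.I))]

lemma norm_cos_le_exp_abs_im (z : ℂ) : ‖Complex.cos z‖ ≤ Real.exp |z.im| := by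
  have h := norm_sin_le_exp_abs_im (z + (Real.pi / 2 : ℝ))
  rw [Complex.add_im, Complex.ofReal_im, add_zero] at h
  push_cast at h
  rwa [Complex.sin_add_pi_div_two] at h

/-- Mean value inequality on the convex strip `|Im w| ≤ |Im z|`, where the derivative is controlled.
It keeps `sin(πz)/z` bounded near its removable singularity. -/
lemma norm_sin_le_norm_mul_exp_abs_im (z : ℂ) :
    ‖Complex.sin z‖ ≤ ‖z‖ * Real.exp |z.im| := by
  have h := Convex.norm_image_sub_le_of_norm_deriv_le (f := Complex.sin)
    (s := {w : ℂ | -|z.im| ≤ w.im} ∩ {w : ℂ | w.im ≤ |z.im|}) (x := 0) (y := z)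
    (C := Real.exp |z.im|) (fun w _ => Complex.differentiable_sin w)
    (fun w hw => by
      rw [Complex.deriv_sin]
      exact (norm_cos_le_exp_abs_im w).trans (Real.exp_le_exp.2 (abs_le.2 hw)))
    ((convex_halfSpace_im_ge _).inter (convex_halfSpace_im_le _))
    (by simp) ⟨neg_abs_le z.im, le_abs_self z.im⟩
  simpa [mul_comm] using h

lemma differentiable_sin_pi : Differentiable ℂ fun w : ℂ => Complex.sin (Real.pi * w) := by
  fun_prop

lemma sin_pi_intCast (k : ℤ) : Complex.sin (Real.pi * (k : ℂ)) = 0 := by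
  rw [mul_comm]; exact Complex.sin_int_mul_pi k

lemma cos_pi_intCast (k : ℤ) : Complex.cos (Real.pi * (k : ℂ)) = (-1) ^ k := by
  have h := congrArg Complex.ofReal (Real.cos_int_mul_pi k)
  push_cast at h
  rwa [mul_comm] at h

lemma deriv_sin_pi (z : ℂ) :
    deriv (fun w : ℂ => Complex.sin (Real.pi * w)) z = Real.pi * Complex.cos (Real.pi * z) := by
  simp [mul_comm]

lemma norm_sin_pi_le (z : ℂ) :
    ‖Complex.sin (Real.pi * z)‖ ≤ Real.exp (Real.pi * |z.im|) := by
  simpa [abs_mul, abs_of_pos Real.pi_pos] using norm_sin_le_exp_abs_im (Real.pi * z)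

/-- The entire function `sin(πz)/(z - k)`. -/
def sinQuot (k : ℤ) (z : ℂ) : ℂ := dslope (fun w : ℂ => Complex.sin (Real.pi * w)) k z

lemma sinQuot_of_ne {k : ℤ} {z : ℂ} (h : z ≠ k) :
    sinQuot k z = Complex.sin (Real.pi * z) / (z - k) := by
  rw [sinQuot, dslope_of_ne _ h, slope_def_field, sin_pi_intCast, sub_zero]

lemma sinQuot_self (k : ℤ) : sinQuot k k = Real.pi * (-1) ^ k := by
  rw [sinQuot, dslope_same, deriv_sin_pi, cos_pi_intCast]

lemma sinQuot_intCast_of_ne {j k : ℤ} (h : j ≠ k) : sinQuot k j = 0 := by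
  rw [sinQuot_of_ne (by exact_mod_cast h), sin_pi_intCast, zero_div]

lemma differentiable_sinQuot (k : ℤ) : Differentiable ℂ (sinQuot k) := by
  rw [← differentiableOn_univ]
  exact (Complex.differentiableOn_dslope univ_mem).2 differentiable_sin_pi.differentiableOn

/-! ### A locally uniform Weierstrass test -/

lemma hasSumLocallyUniformly_of_norm_le {ι : Type*} {f : ι → ℂ → ℂ}
    (h : ∀ R : ℝ, 0 < R → ∃ u : ι → ℝ, Summable u ∧
      ∀ᶠ i in cofinite, ∀ z : ℂ, ‖z‖ ≤ R → ‖f i z‖ ≤ u i) :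
    HasSumLocallyUniformly f fun z => ∑' i, f i z := by
  rw [hasSumLocallyUniformly_iff_tendstoLocallyUniformly]
  intro v hv z
  obtain ⟨u, hu, hb⟩ := h (‖z‖ + 1) (by positivity)
  have H := tendstoUniformlyOn_tsum_of_cofinite_eventually (f := f)
    (s := Metric.closedBall 0 (‖z‖ + 1)) hu (by simpa using hb)
  refine ⟨Metric.closedBall 0 (‖z‖ + 1), ?_, H v hv⟩
  refine mem_of_superset (Metric.closedBall_mem_nhds z one_pos) fun y hy => ?_
  rw [mem_closedBall_zero_iff]
  rw [mem_closedBall_iff_norm] at hy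
  linarith [norm_le_norm_add_norm_sub' y z]

/-! ### The interpolation series of the step samples -/

/-- For `k ≥ 0` the entire function `sin(πz) (1/(z - k) - 1/(w - k))`, and `0` for `k < 0`. -/
def stepTerm (w : ℂ) (k : ℤ) (z : ℂ) : ℂ :=
  if k < 0 then 0 else sinQuot k z - Complex.sin (Real.pi * z) / (w - k)

lemma stepTerm_of_neg (w z : ℂ) {k : ℤ} (hk : k < 0) : stepTerm w k z = 0 := if_pos hk

lemma stepTerm_natCast (w z : ℂ) (k : ℕ) :
    stepTerm w k z = sinQuot k z - Complex.sin (Real.pi * z) / (w - k) := by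
  simp [stepTerm]

lemma differentiable_stepTerm (w : ℂ) (k : ℤ) : Differentiable ℂ (stepTerm w k) := by
  unfold stepTerm
  split_ifs
  · exact differentiable_const 0
  · exact (differentiable_sinQuot k).sub (differentiable_sin_pi.div_const _)

/-- The difference `1/(z-k) - 1/(w-k)` equals `(w-z)/((z-k)(w-k))`, and both factors below are at
least `|k|/2`; this is the source of the 4. -/
lemma norm_stepTerm_le {w z : ℂ} {R : ℝ} {k : ℤ} (hz : ‖z‖ ≤ R)
    (hk : 2 * (R + ‖w‖) < |(k : ℝ)|) :
    ‖stepTerm w k z‖ ≤ Real.exp (Real.pi * R) * (R + ‖w‖) * 4 * (1 / (k : ℝ) ^ 2) := by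
  have hR : 0 ≤ R := (norm_nonneg z).trans hz
  have hk0 : 0 < |(k : ℝ)| := lt_of_le_of_lt (by positivity) hk
  by_cases hneg : k < 0
  · rw [stepTerm_of_neg _ _ hneg, norm_zero]; positivity
  have key : ∀ y : ℂ, ‖y‖ ≤ R + ‖w‖ → |(k : ℝ)| / 2 ≤ ‖y - k‖ := by
    intro y hy
    have h1 : |(k : ℝ)| = ‖(k : ℂ)‖ := by simp
    have h2 := norm_sub_norm_le (k : ℂ) y
    rw [norm_sub_rev, ← h1] at h2
    linarith
  have hzk := key z (by linarith [norm_nonneg w])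
  have hwk := key w (by linarith)
  have hz0 : z - k ≠ 0 := norm_pos_iff.1 (lt_of_lt_of_le (by positivity) hzk)
  have hw0 : w - k ≠ 0 := norm_pos_iff.1 (lt_of_lt_of_le (by positivity) hwk)
  have heq : stepTerm w k z =
      Complex.sin (Real.pi * z) * (w - z) / ((z - k) * (w - k)) := by
    rw [stepTerm, if_neg hneg, sinQuot_of_ne (sub_ne_zero.1 hz0)]
    field_simp
    ring
  rw [heq, norm_div, norm_mul, norm_mul]
  have hs : ‖Complex.sin (Real.pi * z)‖ ≤ Real.exp (Real.pi * R) :=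
    (norm_sin_pi_le z).trans (Real.exp_le_exp.2 (by
      have := Complex.abs_im_le_norm z
      gcongr
      linarith))
  have hd : ‖w - z‖ ≤ R + ‖w‖ := by linarith [norm_sub_le w z]
  calc _ ≤ Real.exp (Real.pi * R) * (R + ‖w‖) / (|(k : ℝ)| / 2 * (|(k : ℝ)| / 2)) := by gcongr
    _ = _ := by
      rw [← sq_abs (k : ℝ)]
      field_simp
      norm_num

lemma hasSumLocallyUniformly_stepTerm (w : ℂ) :
    HasSumLocallyUniformly (stepTerm w) fun z => ∑' k, stepTerm w k z := by
  refine hasSumLocallyUniformly_of_norm_le fun R hR =>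
    ⟨_, (Real.summable_one_div_int_pow.2 one_lt_two).mul_left
      (Real.exp (Real.pi * R) * (R + ‖w‖) * 4), ?_⟩
  have hlim : ∀ᶠ k : ℤ in cofinite, 2 * (R + ‖w‖) < |(k : ℝ)| :=
    (tendsto_norm_cocompact_atTop.comp Int.tendsto_coe_cofinite).eventually_gt_atTop _
  filter_upwards [hlim] with k hk z hz using norm_stepTerm_le hz hk

lemma summable_stepTerm (w z : ℂ) : Summable fun k : ℤ => stepTerm w k z := by
  refine Summable.of_norm_bounded_eventually
    ((Real.summable_one_div_int_pow.2 one_lt_two).mul_left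
      (Real.exp (Real.pi * ‖z‖) * (‖z‖ + ‖w‖) * 4)) ?_
  have hlim : ∀ᶠ k : ℤ in cofinite, 2 * (‖z‖ + ‖w‖) < |(k : ℝ)| :=
    (tendsto_norm_cocompact_atTop.comp Int.tendsto_coe_cofinite).eventually_gt_atTop _
  filter_upwards [hlim] with k hk using norm_stepTerm_le le_rfl hk

lemma support_stepTerm_subset (w z : ℂ) :
    (Function.support fun k : ℤ => stepTerm w k z) ⊆ Set.range ((↑) : ℕ → ℤ) := by
  intro k hk
  rcases lt_or_ge k 0 with h | h
  · exact absurd (stepTerm_of_neg w z h) hk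
  · exact ⟨k.toNat, Int.toNat_of_nonneg h⟩

lemma tsum_stepTerm_eq_tsum_nat (w z : ℂ) :
    ∑' k : ℤ, stepTerm w k z = ∑' k : ℕ, stepTerm w k z :=
  (Nat.cast_injective.tsum_eq (support_stepTerm_subset w z)).symm

lemma summable_stepTerm_nat (w z : ℂ) : Summable fun k : ℕ => stepTerm w k z :=
  (summable_stepTerm w z).comp_injective Nat.cast_injective

/-- The entire function that `sin(πz) ψ(-z)` extends to, given by its partial fraction series. -/
def sinDigamma (z : ℂ) : ℂ :=
  ∑' k : ℤ, stepTerm (-1) k z - Real.eulerMascheroniConstant * Complex.sin (Real.pi * z)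

lemma differentiable_sinDigamma : Differentiable ℂ sinDigamma := by
  refine Differentiable.sub ?_ (differentiable_sin_pi.const_mul _)
  rw [← differentiableOn_univ]
  refine TendstoLocallyUniformlyOn.differentiableOn (φ := atTop)
    (tendstoLocallyUniformlyOn_univ.2 (hasSumLocallyUniformly_iff_tendstoLocallyUniformly.1
      (hasSumLocallyUniformly_stepTerm (-1)))) (Eventually.of_forall fun s => ?_) isOpen_univ
  exact (Differentiable.fun_sum fun k _ => differentiable_stepTerm _ k).differentiableOn

/-- The base point `-1` produces exactly the digamma summand `1/(z-k) + 1/(k+1)`. Although an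
integer, it is harmless because only nodes `k ≥ 0` contribute. -/
lemma stepTerm_neg_one {z : ℂ} (k : ℕ) (hz : z ≠ k) :
    stepTerm (-1) k z = Complex.sin (Real.pi * z) * ((z + 1) / ((k + 1) * (z - k))) := by
  have h1 : (-1 - (k : ℂ)) ≠ 0 := by
    rw [← neg_add', neg_ne_zero, add_comm]; exact_mod_cast k.succ_ne_zero
  have h2 : (k : ℂ) + 1 ≠ 0 := by exact_mod_cast k.succ_ne_zero
  have h3 := sub_ne_zero.2 hz
  rw [stepTerm_natCast, sinQuot_of_ne (by exact_mod_cast hz)]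
  push_cast
  have h4 : -1 - (k : ℂ) = -(k + 1) := by ring
  rw [h4]
  field_simp
  ring

lemma sinDigamma_eq {z : ℂ} (hz : ∀ n : ℕ, z ≠ n) :
    sinDigamma z = Complex.sin (Real.pi * z) *
      (∑' k : ℕ, (z + 1) / ((k + 1) * (z - k)) - Real.eulerMascheroniConstant) := by
  rw [sinDigamma, tsum_stepTerm_eq_tsum_nat, mul_sub, ← tsum_mul_left, mul_comm (Complex.ofReal _)]
  congr 1
  exact tsum_congr fun k => stepTerm_neg_one k (hz k)

lemma sinDigamma_intCast (k : ℤ) : sinDigamma k = stepSamples k := by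
  rw [sinDigamma, sin_pi_intCast, mul_zero, sub_zero, tsum_eq_single k]
  · by_cases hk : k < 0
    · rw [stepTerm_of_neg _ _ hk, stepSamples, if_pos hk]
    · rw [stepTerm, if_neg hk, stepSamples, if_neg hk, sinQuot_self, sin_pi_intCast, zero_div,
        sub_zero, mul_comm]
  · intro j hj
    by_cases hj0 : j < 0
    · exact stepTerm_of_neg _ _ hj0
    · rw [stepTerm, if_neg hj0, sinQuot_intCast_of_ne hj.symm, sin_pi_intCast, zero_div, sub_zero]

/-! ### The digamma function on the positive half-line -/

lemma differentiableAt_log_Gamma {x : ℝ} (hx : 0 < x) :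
    DifferentiableAt ℝ (Real.log ∘ Real.Gamma) x :=
  (Real.differentiableAt_Gamma fun m => ne_of_gt (by linarith [m.cast_nonneg (α := ℝ)])).log
    (Real.Gamma_pos_of_pos hx).ne'

lemma deriv_log_Gamma_add_one {x : ℝ} (hx : 0 < x) :
    deriv (Real.log ∘ Real.Gamma) (x + 1) = deriv (Real.log ∘ Real.Gamma) x + 1 / x := by
  rw [← deriv_comp_add_const, one_div, ← Real.deriv_log,
    ← deriv_add (differentiableAt_log_Gamma hx) (Real.differentiableAt_log hx.ne')]
  refine EventuallyEq.deriv_eq ?_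
  filter_upwards [eventually_gt_nhds hx] with y hy
  simp [Real.Gamma_add_one hy.ne', Real.log_mul hy.ne' (Real.Gamma_pos_of_pos hy).ne', add_comm]

lemma deriv_log_Gamma_add_nat {x : ℝ} (hx : 0 < x) (n : ℕ) :
    deriv (Real.log ∘ Real.Gamma) (x + n) =
      deriv (Real.log ∘ Real.Gamma) x + ∑ k ∈ Finset.range n, 1 / (x + k) := by
  induction n with
  | zero => simp
  | succ n ih =>
    rw [Nat.cast_succ, ← add_assoc, deriv_log_Gamma_add_one (by positivity), ih,
      Finset.sum_range_succ, add_assoc]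

lemma digamma_ofReal {x : ℝ} (hx : 0 < x) :
    Complex.digamma x = (deriv (Real.log ∘ Real.Gamma) x : ℝ) := by
  have hd : DifferentiableAt ℂ Complex.Gamma x := Complex.differentiableAt_Gamma _ fun m => by
    rw [← Complex.ofReal_natCast, ← Complex.ofReal_neg, Ne, Complex.ofReal_inj]
    exact ne_of_gt (by linarith [m.cast_nonneg (α := ℝ)])
  have hr : DifferentiableAt ℝ Real.Gamma x :=
    Real.differentiableAt_Gamma fun m => ne_of_gt (by linarith [m.cast_nonneg (α := ℝ)])
  have h1 : deriv Complex.Gamma x = (deriv Real.Gamma x : ℝ) := by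
    have h := hd.hasDerivAt.comp_ofReal
    simp_rw [Complex.Gamma_ofReal] at h
    exact h.unique hr.hasDerivAt.ofReal_comp
  rw [Complex.digamma_def, logDeriv_apply, h1, Complex.Gamma_ofReal, Function.comp_def,
    deriv.log hr (Real.Gamma_pos_of_pos hx).ne', Complex.ofReal_div]

/-- By log-convexity `ψ = (log Γ)'` increases, so `0 ≤ ψ(x+n) - ψ(1+n) ≤ ψ(2+n) - ψ(1+n) = 1/(n+1)`.
The functional equation turns this vanishing difference into the partial sums. -/
lemma tendsto_sum_sub_deriv_log_Gamma {x : ℝ} (hx : x ∈ Set.Icc (1 : ℝ) 2) :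
    Tendsto (fun n : ℕ => ∑ k ∈ Finset.range n, (1 / ((1 : ℝ) + k) - 1 / (x + k))) atTop
      (𝓝 (deriv (Real.log ∘ Real.Gamma) x - deriv (Real.log ∘ Real.Gamma) 1)) := by
  set g := deriv (Real.log ∘ Real.Gamma)
  have hx0 : 0 < x := by linarith [hx.1]
  have hmono : MonotoneOn g (Set.Ioi 0) :=
    Real.convexOn_log_Gamma.monotoneOn_deriv fun y hy => differentiableAt_log_Gamma hy
  have hlim : Tendsto (fun n : ℕ => g (x + n) - g (1 + n)) atTop (𝓝 0) := by
    refine squeeze_zero (fun n => ?_) (fun n => ?_) tendsto_one_div_add_atTop_nhds_zero_nat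
    · exact sub_nonneg.2 (hmono (Set.mem_Ioi.2 (by positivity)) (Set.mem_Ioi.2 (by positivity))
        (by linarith [hx.1]))
    · have h1 : g (x + n) ≤ g ((1 + n) + 1) :=
        hmono (Set.mem_Ioi.2 (by positivity)) (Set.mem_Ioi.2 (by positivity)) (by linarith [hx.2])
      have h2 : g ((1 + n : ℝ) + 1) = g (1 + n) + 1 / (1 + n) :=
        deriv_log_Gamma_add_one (by positivity)
      rw [add_comm (n : ℝ) 1]
      linarith
  have h := hlim.const_sub (g x - g 1)
  rw [sub_zero] at h
  refine h.congr fun n => ?_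
  rw [Finset.sum_sub_distrib]
  have h1 : g (x + n) = _ := deriv_log_Gamma_add_nat hx0 n
  have h2 : g (1 + n) = _ := deriv_log_Gamma_add_nat one_pos n
  rw [h1, h2]
  ring

lemma sinDigamma_neg_ofReal {x : ℝ} (hx : x ∈ Set.Icc (1 : ℝ) 2) :
    sinDigamma (-x) = Complex.sin (Real.pi * (-x : ℂ)) * Complex.digamma (-(-x : ℂ)) := by
  have hx0 : 0 < x := by linarith [hx.1]
  have hne : ∀ n : ℕ, (-x : ℂ) ≠ n := fun n h => by
    have h' : -x = n := by exact_mod_cast h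
    linarith [n.cast_nonneg (α := ℝ)]
  -- At the endpoints both sides vanish; elsewhere the sine can be cancelled to obtain summability
  -- of the digamma series.
  by_cases hs : Complex.sin (Real.pi * (-x : ℂ)) = 0
  · rw [sinDigamma_eq hne, hs, zero_mul, zero_mul]
  have hsum : Summable fun k : ℕ => ((-x : ℂ) + 1) / ((k + 1) * (-x - k)) := by
    have h := summable_stepTerm_nat (-1) (-x)
    simp_rw [fun k : ℕ => stepTerm_neg_one k (hne k)] at h
    exact (summable_mul_left_iff hs).1 h
  have h1 := hsum.hasSum.tendsto_sum_nat
  have h2 : Tendsto (fun n : ℕ => ∑ k ∈ Finset.range n, ((-x : ℂ) + 1) / ((k + 1) * (-x - k))) atTop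
      (𝓝 ((deriv (Real.log ∘ Real.Gamma) x - deriv (Real.log ∘ Real.Gamma) 1 : ℝ) : ℂ)) := by
    refine ((Complex.continuous_ofReal.tendsto _).comp
      (tendsto_sum_sub_deriv_log_Gamma hx)).congr fun n => ?_
    rw [Function.comp_apply, Complex.ofReal_sum]
    refine Finset.sum_congr rfl fun k _ => ?_
    have h3 : (1 : ℝ) + k ≠ 0 := by positivity
    have h4 : x + k ≠ 0 := by positivity
    have h5 : (-(x : ℂ) + 1) / ((k + 1) * (-x - k)) =
        ((-x + 1) / ((k + 1) * (-x - k)) : ℝ) := by push_cast; rfl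
    rw [h5]
    congr 1
    rw [show (k + 1) * (-x - k) = -((1 + k) * (x + k)) by ring]
    field_simp
    ring
  have hγ : Complex.digamma 1 = (deriv (Real.log ∘ Real.Gamma) 1 : ℝ) := by
    simpa using digamma_ofReal one_pos
  rw [sinDigamma_eq hne, tendsto_nhds_unique h1 h2, neg_neg, digamma_ofReal hx0, Complex.ofReal_sub,
    ← hγ, Complex.digamma_one]
  ring

/-! ### Identification of `G₁` -/

lemma isClosed_natCast_image (s : Set ℕ) : IsClosed (((↑) : ℕ → ℂ) '' s) := by
  have h : ((↑) : ℕ → ℂ) '' s = ((↑) : ℤ → ℂ) '' (((↑) : ℕ → ℤ) '' s) := by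
    simp [Set.image_image]
  rw [h]
  exact Complex.isClosedEmbedding_intCast.isClosedMap _ (isClosed_discrete _)

lemma isClosed_range_natCast_complex : IsClosed (Set.range ((↑) : ℕ → ℂ)) :=
  Set.image_univ ▸ isClosed_natCast_image Set.univ

lemma eventually_ne_natCast (z : ℂ) : ∀ᶠ w : ℂ in 𝓝[≠] z, ∀ n : ℕ, w ≠ n := by
  have hz : z ∈ (((↑) : ℕ → ℂ) '' {n : ℕ | (n : ℂ) ≠ z})ᶜ := by
    rintro ⟨n, hn, rfl⟩
    exact hn rfl
  filter_upwards [self_mem_nhdsWithin, mem_nhdsWithin_of_mem_nhds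
    ((isClosed_natCast_image _).isOpen_compl.mem_nhds hz)] with w hw hw' n hn
  exact hw' ⟨n, fun h => hw (hn.trans h), hn.symm⟩

lemma analyticAt_digamma_neg {z : ℂ} (hz : ∀ n : ℕ, z ≠ n) :
    AnalyticAt ℂ (fun w => Complex.digamma (-w)) z := by
  have hU : IsOpen (Set.range ((↑) : ℕ → ℂ))ᶜ := isClosed_range_natCast_complex.isOpen_compl
  have hG : DifferentiableOn ℂ Complex.Gamma ((fun w => -w) ⁻¹' (Set.range ((↑) : ℕ → ℂ))ᶜ) :=
    fun w hw => (Complex.differentiableAt_Gamma w fun m hm =>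
      hw ⟨m, by simp [hm]⟩).differentiableWithinAt
  have hU' : IsOpen ((fun w : ℂ => -w) ⁻¹' (Set.range ((↑) : ℕ → ℂ))ᶜ) := hU.preimage continuous_neg
  have hmem : -z ∈ (fun w : ℂ => -w) ⁻¹' (Set.range ((↑) : ℕ → ℂ))ᶜ := by
    rintro ⟨n, hn⟩; exact hz n (by simpa using hn.symm)
  have hA : AnalyticAt ℂ Complex.Gamma (-z) := hG.analyticAt (hU'.mem_nhds hmem)
  have hd : AnalyticAt ℂ Complex.digamma (-z) :=
    hA.deriv.div hA (Complex.Gamma_ne_zero fun m hm => hz m (by simpa using hm))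
  exact AnalyticAt.fun_comp hd analyticAt_id.neg

/-- Identity theorem on `ℂ ∖ ℕ`, which is connected as the complement of a countable set; agreement
is known on the real interval around `-3/2`. -/
lemma sinDigamma_eq_sin_mul_digamma {z : ℂ} (hz : ∀ n : ℕ, z ≠ n) :
    sinDigamma z = Complex.sin (Real.pi * z) * Complex.digamma (-z) := by
  have hU : IsPreconnected (Set.range ((↑) : ℕ → ℂ))ᶜ :=
    ((Set.countable_range _).isPathConnected_compl_of_one_lt_rank
      (by simp [Complex.rank_real_complex])).isConnected.isPreconnected
  refine AnalyticOnNhd.eqOn_of_preconnected_of_frequently_eq (U := (Set.range ((↑) : ℕ → ℂ))ᶜ)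
    (f := sinDigamma) (g := fun z => Complex.sin (Real.pi * z) * Complex.digamma (-z))
    (z₀ := ((-(3 / 2) : ℝ) : ℂ))
    (fun w _ => differentiable_sinDigamma.analyticAt w)
    (fun w hw => (differentiable_sin_pi.analyticAt w).mul
      (analyticAt_digamma_neg fun n hn => hw ⟨n, hn.symm⟩)) hU ?_ ?_
    (show z ∈ (Set.range ((↑) : ℕ → ℂ))ᶜ from fun ⟨n, hn⟩ => hz n hn.symm)
  · rintro ⟨n, hn⟩
    have h' : (n : ℝ) = -(3 / 2) := by exact_mod_cast hn
    linarith [n.cast_nonneg (α := ℝ)]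
  · have hlim : Tendsto ((↑) : ℝ → ℂ) (𝓝[≠] (-(3 / 2))) (𝓝[≠] ((-(3 / 2) : ℝ) : ℂ)) :=
      Complex.continuous_ofReal.continuousAt.continuousWithinAt.tendsto_nhdsWithin
        fun y hy => fun h => hy (Complex.ofReal_injective h)
    refine hlim.frequently (Eventually.frequently ?_)
    filter_upwards [mem_nhdsWithin_of_mem_nhds
      (Icc_mem_nhds (a := (-2 : ℝ)) (b := -1) (x := -(3 / 2)) (by norm_num) (by norm_num))] with y hy
    have h := sinDigamma_neg_ofReal (x := -y) ⟨by linarith [hy.2], by linarith [hy.1]⟩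
    simpa using h

lemma G₁_eq_sinDigamma : G₁ = sinDigamma := by
  funext z
  refine Tendsto.limUnder_eq ?_
  refine (differentiable_sinDigamma.continuous.tendsto z |>.mono_left nhdsWithin_le_nhds).congr' ?_
  filter_upwards [eventually_ne_natCast z] with w hw using sinDigamma_eq_sin_mul_digamma hw

/-! ### The bandlimited interpolation -/

lemma interpKernel_eq (x : ℝ) (k : ℤ) (z : ℂ) :
    interpKernel x k z =
      (-1) ^ k / Real.pi * (sinQuot k z - Complex.sin (Real.pi * z) / (x - k)) := by
  have hπ : (Real.pi : ℂ) ≠ 0 := by exact_mod_cast Real.pi_ne_zero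
  have hd : deriv intGenFun (k : ℂ) = (-1) ^ k := by
    unfold intGenFun
    rw [deriv_div_const, deriv_sin_pi, cos_pi_intCast, mul_div_cancel_left₀ _ hπ]
  have h1 : ((-1 : ℂ) ^ k) * (-1) ^ k = 1 := by
    rw [← mul_zpow]; simp
  have hc : Continuous fun w => (-1 : ℂ) ^ k / Real.pi *
      (sinQuot k w - Complex.sin (Real.pi * w) / (x - k)) :=
    continuous_const.mul ((differentiable_sinQuot k).continuous.sub
      (differentiable_sin_pi.continuous.div_const _))
  refine Tendsto.limUnder_eq ((hc.tendsto z |>.mono_left nhdsWithin_le_nhds).congr' ?_)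
  have hne : ∀ᶠ w in 𝓝[≠] z, w ≠ (k : ℂ) := by
    rcases eq_or_ne z k with rfl | h
    · exact self_mem_nhdsWithin
    · exact mem_nhdsWithin_of_mem_nhds (isOpen_ne.mem_nhds h)
  filter_upwards [hne] with w hw
  rw [hd, intGenFun, sinQuot_of_ne hw, div_eq_mul_inv _ ((-1 : ℂ) ^ k), inv_eq_of_mul_eq_one_left h1]
  ring

lemma stepSamples_mul_interpKernel (x : ℝ) (k : ℤ) (z : ℂ) :
    stepSamples k * interpKernel x k z = stepTerm x k z := by
  have hπ : (Real.pi : ℂ) ≠ 0 := by exact_mod_cast Real.pi_ne_zero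
  by_cases hk : k < 0
  · rw [stepTerm_of_neg _ _ hk, stepSamples, if_pos hk, zero_mul]
  have h1 : ((-1 : ℂ) ^ k) * (-1) ^ k = 1 := by
    rw [← mul_zpow]; simp
  rw [stepTerm, if_neg hk, stepSamples, if_neg hk, interpKernel_eq]
  field_simp
  linear_combination (sinQuot k z - Complex.sin (Real.pi * z) / (x - k)) * h1

lemma exists_isBandlimitedInterp {x : ℝ} (hx : ∀ k : ℤ, x ≠ k) (a' : ℂ) :
    ∃ c : ℂ, IsBandlimitedInterp stepSamples x a'
      fun z => sinDigamma z + c * Complex.sin (Real.pi * z) := by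
  have hπ : (Real.pi : ℂ) ≠ 0 := by exact_mod_cast Real.pi_ne_zero
  have hsin : Complex.sin (Real.pi * (x : ℂ)) ≠ 0 := by
    intro h
    obtain ⟨k, hk⟩ := Complex.sin_eq_zero_iff.1 h
    rw [mul_comm, mul_left_inj' hπ] at hk
    exact hx k (by exact_mod_cast hk)
  have hdiff : ∀ z, ∑' k, stepTerm x k z - ∑' k, stepTerm (-1) k z =
      Complex.sin (Real.pi * z) *
        ∑' k : ℤ, if k < 0 then 0 else (1 / (-1 - k : ℂ) - 1 / (x - k)) := by
    intro z
    rw [← (summable_stepTerm x z).tsum_sub (summable_stepTerm (-1) z), ← tsum_mul_left]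
    refine tsum_congr fun k => ?_
    unfold stepTerm
    split_ifs
    · simp
    · ring
  set κ := ∑' k : ℤ, if k < 0 then 0 else (1 / (-1 - k : ℂ) - 1 / (x - k))
  -- Here `κ` comes from moving the base point from `-1` to `x`, Euler's constant cancels the one in
  -- `sinDigamma`, and the last term is the extra sample.
  refine ⟨κ + Real.eulerMascheroniConstant + a' / Complex.sin (Real.pi * x), ?_⟩
  unfold IsBandlimitedInterp
  convert hasSumLocallyUniformly_stepTerm (x : ℂ) using 1
  · funext k z
    exact stepSamples_mul_interpKernel x k z
  · funext z
    rw [← sub_add_cancel (∑' k, stepTerm x k z) (∑' k, stepTerm (-1) k z), hdiff]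
    simp only [sinDigamma, intGenFun]
    field_simp
    ring

/-! ### Growth in the complex plane -/

lemma summable_one_div_succ_sq : Summable fun k : ℕ => 1 / ((k : ℝ) + 1) ^ 2 := by
  have h := (summable_nat_add_iff 1).2 (Real.summable_one_div_nat_pow.2 one_lt_two)
  simpa using h

/-- In this half-plane `|z - k| ≥ k + 1`, so the partial fraction series is dominated by `‖z+1‖ ∑
1/(k+1)²`. -/
lemma norm_sinDigamma_le_of_re_le {z : ℂ} (hz : z.re ≤ -1) :
    ‖sinDigamma z‖ ≤ Real.exp (Real.pi * |z.im|) *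
      (‖z + 1‖ * ∑' k : ℕ, 1 / ((k : ℝ) + 1) ^ 2 + |Real.eulerMascheroniConstant|) := by
  have hre : ∀ k : ℕ, (k : ℝ) + 1 ≤ ‖z - k‖ := fun k => by
    have h := (neg_le_abs _).trans (Complex.abs_re_le_norm (z - k))
    rw [Complex.sub_re, Complex.natCast_re] at h
    linarith
  have hne : ∀ n : ℕ, z ≠ n := fun n h => by
    have := hre n
    rw [h, sub_self, norm_zero] at this
    linarith [n.cast_nonneg (α := ℝ)]
  have hterm : ∀ k : ℕ, ‖(z + 1) / ((k + 1) * (z - k))‖ ≤ ‖z + 1‖ * (1 / ((k : ℝ) + 1) ^ 2) := by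
    intro k
    have h1 : ‖(k : ℂ) + 1‖ = (k : ℝ) + 1 := by exact_mod_cast Complex.norm_natCast (k + 1)
    rw [norm_div, norm_mul, h1, div_eq_mul_one_div, pow_two]
    have := hre k
    gcongr
  rw [sinDigamma_eq hne, norm_mul]
  gcongr
  · exact norm_sin_pi_le z
  · refine (norm_sub_le _ _).trans (add_le_add ?_ (by rw [Complex.norm_real, Real.norm_eq_abs]))
    rw [← tsum_mul_left]
    exact tsum_of_norm_bounded (summable_one_div_succ_sq.mul_left _).hasSum hterm

/-- The digamma recurrence reads `F(z+1) = -F(z) + sin(π(z+1))/(z+1)` for `F = sinDigamma`, so a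
unit shift costs only a bounded multiple of `e^{π|Im z|}`. -/
lemma norm_sinDigamma_add_one_le {z : ℂ} (hz : ∀ k : ℤ, z ≠ k) :
    ‖sinDigamma (z + 1)‖ ≤ ‖sinDigamma z‖ + Real.pi * Real.exp (Real.pi * |z.im|) := by
  have hne : ∀ n : ℕ, z ≠ n := fun n h => hz n (by exact_mod_cast h)
  have hne1 : ∀ n : ℕ, z + 1 ≠ n := fun n h =>
    hz (n - 1) (by push_cast; linear_combination h)
  have hz1 : z + 1 ≠ 0 := by simpa using hne1 0
  have hdig : Complex.digamma (-z) = Complex.digamma (-(z + 1)) + (-(z + 1))⁻¹ := by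
    have h := Complex.digamma_apply_add_one (-(z + 1)) fun m hm => hne1 m (neg_injective hm)
    rwa [show -(z + 1) + 1 = -z by ring] at h
  have hsin : Complex.sin (Real.pi * (z + 1)) = -Complex.sin (Real.pi * z) := by
    rw [mul_add, mul_one, Complex.sin_add_pi]
  have heq : sinDigamma (z + 1) =
      -sinDigamma z + Complex.sin (Real.pi * (z + 1)) / (z + 1) := by
    rw [sinDigamma_eq_sin_mul_digamma hne, sinDigamma_eq_sin_mul_digamma hne1, hdig, hsin]
    field_simp
    ring
  rw [heq]
  refine (norm_add_le _ _).trans ?_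
  rw [norm_neg]
  gcongr
  rw [norm_div, div_le_iff₀ (norm_pos_iff.2 hz1)]
  have h := norm_sin_le_norm_mul_exp_abs_im (Real.pi * (z + 1))
  rw [norm_mul, Complex.norm_real, Real.norm_of_nonneg Real.pi_pos.le,
    Complex.im_ofReal_mul, Complex.add_im, Complex.one_im, add_zero, abs_mul,
    abs_of_pos Real.pi_pos] at h
  linarith

lemma norm_sinDigamma_add_nat_le {z : ℂ} (hz : ∀ k : ℤ, z ≠ k) (n : ℕ) :
    ‖sinDigamma (z + n)‖ ≤ ‖sinDigamma z‖ + n * (Real.pi * Real.exp (Real.pi * |z.im|)) := by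
  induction n with
  | zero => simp
  | succ n ih =>
    have h := norm_sinDigamma_add_one_le (z := z + n) fun k hk =>
      hz (k - n) (by push_cast; linear_combination hk)
    rw [Complex.add_im, Complex.natCast_im, add_zero] at h
    push_cast
    rw [← add_assoc]
    linarith

lemma exists_norm_sinDigamma_le : ∃ A : ℝ, 0 ≤ A ∧ ∀ z : ℂ,
    ‖sinDigamma z‖ ≤ A * (1 + ‖z‖) * Real.exp (Real.pi * |z.im|) := by
  set Z := ∑' k : ℕ, 1 / ((k : ℝ) + 1) ^ 2
  have hZ : 0 ≤ Z := tsum_nonneg fun k => by positivity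
  set γ := |Real.eulerMascheroniConstant|
  have hγ : 0 ≤ γ := abs_nonneg _
  refine ⟨4 * Z + γ + 2 * Real.pi, by positivity, fun z => ?_⟩
  -- The shift estimate holds off `ℤ`; the desired bound is a closed condition, so it extends by
  -- density.
  have hdense : Dense (Set.range ((↑) : ℤ → ℂ))ᶜ :=
    (Set.countable_range _).dense_compl ℝ
  have hclosed : IsClosed {z : ℂ | ‖sinDigamma z‖ ≤
      (4 * Z + γ + 2 * Real.pi) * (1 + ‖z‖) * Real.exp (Real.pi * |z.im|)} :=
    isClosed_le differentiable_sinDigamma.continuous.norm (by fun_prop)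
  refine hclosed.closure_subset_iff.2 ?_ (hdense z)
  intro w hw
  have hw' : ∀ k : ℤ, w ≠ k := fun k hk => hw ⟨k, hk.symm⟩
  -- Enough unit steps to bring `w - n` into `Re ≤ -1`, yet at most `‖w‖ + 2` of them, so the total
  -- cost is linear.
  set n := ⌈w.re⌉₊ + 1
  have hn1 : w.re + 1 ≤ n := by push_cast [n]; linarith [Nat.le_ceil w.re]
  have hn2 : (n : ℝ) ≤ ‖w‖ + 2 := by
    have h1 := Nat.ceil_lt_add_one (norm_nonneg w)
    have h2 : ((⌈w.re⌉₊ : ℕ) : ℝ) ≤ (⌈‖w‖⌉₊ : ℕ) :=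
      Nat.cast_le.2 (Nat.ceil_mono (Complex.re_le_norm w))
    push_cast [n]
    linarith
  have h1 := norm_sinDigamma_add_nat_le (z := w - n)
    (fun k hk => hw' (k + n) (by push_cast; linear_combination hk)) n
  have h2 := norm_sinDigamma_le_of_re_le (z := w - n) (by
    rw [Complex.sub_re, Complex.natCast_re]; linarith)
  rw [sub_add_cancel, Complex.sub_im, Complex.natCast_im, sub_zero] at h1
  rw [Complex.sub_im, Complex.natCast_im, sub_zero] at h2
  have h3 : ‖w - n + 1‖ ≤ 2 * ‖w‖ + 3 := by
    have := norm_add_le (w - n) 1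
    have := norm_sub_le w n
    rw [Complex.norm_natCast] at this
    rw [norm_one] at *
    linarith
  set e := Real.exp (Real.pi * |w.im|)
  have he : 0 < e := Real.exp_pos _
  have hnw := norm_nonneg w
  calc ‖sinDigamma w‖ ≤ e * (‖w - n + 1‖ * Z + γ) + n * (Real.pi * e) := by linarith
    _ ≤ e * ((2 * ‖w‖ + 3) * Z + γ) + (‖w‖ + 2) * (Real.pi * e) := by gcongr
    _ ≤ e * ((4 * (1 + ‖w‖)) * Z + γ * (1 + ‖w‖)) + (2 * (1 + ‖w‖)) * (Real.pi * e) := by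
      gcongr
      · linarith
      · nlinarith
      · linarith
    _ = _ := by ring

/-- With linear growth, the weighted integrand times the arc-length factor `r` is at most `A(1+r)/r
≤ 2A` for `r ≥ 1`. -/
lemma sinDigamma_mem_paleyWienerPlus : sinDigamma ∈ PaleyWienerPlus 1 := by
  refine ⟨differentiable_sinDigamma, ?_⟩
  obtain ⟨A, hA, hbound⟩ := exists_norm_sinDigamma_le
  have hle : ∀ᶠ r : ℝ in atTop, (∫⁻ θ in Set.Ioc 0 (2 * Real.pi),
      ‖(circleMap 0 r θ) ^ (-2 : ℤ) *
        (Real.exp (-(Real.pi * 1 * |(circleMap 0 r θ).im|)) : ℂ) *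
          sinDigamma (circleMap 0 r θ)‖ₑ * ENNReal.ofReal r) ≤
      ENNReal.ofReal (2 * A) * ENNReal.ofReal (2 * Real.pi) := by
    filter_upwards [eventually_ge_atTop 1] with r hr
    have hr0 : 0 < r := by linarith
    have hpt : ∀ θ : ℝ, ‖(circleMap 0 r θ) ^ (-2 : ℤ) *
        (Real.exp (-(Real.pi * 1 * |(circleMap 0 r θ).im|)) : ℂ) *
          sinDigamma (circleMap 0 r θ)‖ₑ * ENNReal.ofReal r ≤ ENNReal.ofReal (2 * A) := by
      intro θ
      set z := circleMap 0 r θ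
      have hz : ‖z‖ = r := by simp [z, abs_of_pos hr0]
      rw [← ofReal_norm, ← ENNReal.ofReal_mul (norm_nonneg _)]
      refine ENNReal.ofReal_le_ofReal ?_
      have h := hbound z
      rw [hz] at h
      rw [norm_mul, norm_mul, norm_zpow, hz, Complex.norm_real, Real.norm_of_nonneg
        (Real.exp_pos _).le, mul_one]
      set e := Real.exp (Real.pi * |z.im|)
      have he : Real.exp (-(Real.pi * |z.im|)) = e⁻¹ := Real.exp_neg _
      have he0 : 0 < e := Real.exp_pos _
      rw [he]
      calc r ^ (-2 : ℤ) * e⁻¹ * ‖sinDigamma z‖ * r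
          ≤ r ^ (-2 : ℤ) * e⁻¹ * (A * (1 + r) * e) * r := by gcongr
        _ = A * ((1 + r) / r) := by
          rw [zpow_neg]
          field_simp
        _ ≤ A * 2 := by
          gcongr
          rw [div_le_iff₀ hr0]; linarith
        _ = 2 * A := mul_comm _ _
    calc _ ≤ ∫⁻ _ in Set.Ioc 0 (2 * Real.pi), ENNReal.ofReal (2 * A) := lintegral_mono hpt
      _ = _ := by simp
  refine (limsup_le_of_le (by isBoundedDefault) hle).trans_lt ?_
  exact ENNReal.mul_lt_top ENNReal.ofReal_lt_top ENNReal.ofReal_lt_top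

/-! ### Averages on the real line -/

/-- For `k ≤ s` one has `(s-1)/(s+k) ≥ (s/2)/(2s) = 1/4`, so the first `⌊s⌋` terms dominate a
quarter of a harmonic sum. -/
lemma log_div_four_le_tsum {s : ℝ} (hs : 2 ≤ s) :
    Real.log s / 4 ≤ ∑' k : ℕ, (s - 1) / ((k + 1) * (s + k)) := by
  have hsum : Summable fun k : ℕ => (s - 1) / ((k + 1) * (s + k)) := by
    refine Summable.of_nonneg_of_le (fun k => div_nonneg (by linarith) (by positivity)) (fun k => ?_)
      (summable_one_div_succ_sq.mul_left (s - 1))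
    rw [div_eq_mul_one_div, pow_two]
    refine mul_le_mul_of_nonneg_left ?_ (by linarith)
    exact one_div_le_one_div_of_le (by positivity) 
      (mul_le_mul_of_nonneg_left (by linarith) (by positivity))
  have hfloor : (⌊s⌋₊ : ℝ) ≤ s := Nat.floor_le (by linarith)
  have hlog : Real.log s ≤ harmonic ⌊s⌋₊ :=
    (Real.log_le_log (by linarith) (Nat.lt_floor_add_one s).le).trans
      (by exact_mod_cast log_add_one_le_harmonic ⌊s⌋₊)
  calc Real.log s / 4 ≤ ∑ k ∈ Finset.range ⌊s⌋₊, ((k : ℝ) + 1)⁻¹ / 4 := by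
        rw [← Finset.sum_div]
        gcongr
        simpa [harmonic] using hlog
    _ ≤ ∑ k ∈ Finset.range ⌊s⌋₊, (s - 1) / ((k + 1) * (s + k)) := by
        refine Finset.sum_le_sum fun k hk => ?_
        have hk' : (k : ℝ) ≤ s :=
          (Nat.cast_le.2 (Finset.mem_range.1 hk).le).trans hfloor
        rw [div_le_div_iff₀ (by norm_num) (by positivity)]
        field_simp
        linarith
    _ ≤ _ := hsum.sum_le_tsum _ fun k _ => div_nonneg (by linarith) (by positivity)

lemma sin_sq_mul_le_norm_sinDigamma {s : ℝ} (hs : 2 ≤ s)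
    (h0 : 0 ≤ Real.log s / 4 - Real.eulerMascheroniConstant) :
    Real.sin (Real.pi * -s) ^ 2 * (Real.log s / 4 - Real.eulerMascheroniConstant) ≤
      ‖sinDigamma (-s : ℝ)‖ := by
  have hne : ∀ n : ℕ, ((-s : ℝ) : ℂ) ≠ n := fun n h => by
    have h' : -s = n := by exact_mod_cast h
    linarith [n.cast_nonneg (α := ℝ)]
  have hT := log_div_four_le_tsum hs
  set T := ∑' k : ℕ, (s - 1) / ((k + 1) * (s + k))
  have heq : sinDigamma (-s : ℝ) =
      (Real.sin (Real.pi * -s) * (T - Real.eulerMascheroniConstant) : ℝ) := by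
    rw [sinDigamma_eq hne]
    push_cast [T]
    congr 2
    refine tsum_congr fun k => ?_
    rw [← neg_div_neg_eq, ← mul_neg]
    congr 1 <;> ring
  rw [heq, Complex.norm_real, Real.norm_eq_abs, abs_mul, ← sq_abs,
    abs_of_nonneg (show 0 ≤ T - Real.eulerMascheroniConstant by linarith)]
  have h1 := Real.abs_sin_le_one (Real.pi * -s)
  have h2 := abs_nonneg (Real.sin (Real.pi * -s))
  exact mul_le_mul (by nlinarith) (by linarith) h0 h2

lemma integral_sin_pi_sq_ge {a b : ℝ} :
    (b - a) / 2 - 1 ≤ ∫ t in a..b, Real.sin (Real.pi * t) ^ 2 := by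
  have h := intervalIntegral.integral_comp_mul_left (a := a) (b := b) (fun x => Real.sin x ^ 2)
    Real.pi_ne_zero
  rw [h, integral_sin_sq, smul_eq_mul]
  have hπ := Real.pi_gt_three
  have key : ∀ x : ℝ, |Real.sin x * Real.cos x| ≤ 1 := fun x => by
    rw [abs_mul]
    exact mul_le_one₀ (Real.abs_sin_le_one _) (abs_nonneg _) (Real.abs_cos_le_one _)
  have h1 := (abs_le.1 (key (Real.pi * a))).1
  have h2 := (abs_le.1 (key (Real.pi * b))).2
  rw [inv_mul_eq_div, le_div_iff₀ Real.pi_pos]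
  nlinarith

lemma exists_log_le_average : ∃ C : ℝ, 0 < C ∧ ∀ᶠ r : ℝ in atTop,
    C * Real.log r ≤ 1 / r * ∫ t in (-r)..0, ‖sinDigamma t‖ := by
  -- Only `[-r, -r/2]` is used: there `∫ sin² ≥ r/4 - 1 ≥ r/8` and the logarithmic factor is at
  -- least `log r / 8`.
  refine ⟨1 / 64, by norm_num, ?_⟩
  filter_upwards [eventually_ge_atTop 8, Real.tendsto_log_atTop.eventually_ge_atTop
    (8 * (Real.log 2 / 4 + Real.eulerMascheroniConstant))] with r hr hlog
  have hr0 : 0 < r := by linarith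
  have hcont : Continuous fun t : ℝ => ‖sinDigamma t‖ :=
    (differentiable_sinDigamma.continuous.comp Complex.continuous_ofReal).norm
  set L := Real.log (r / 2) / 4 - Real.eulerMascheroniConstant
  have hL : Real.log r / 8 ≤ L := by
    simp only [L]
    rw [Real.log_div hr0.ne' two_ne_zero]
    linarith
  have hL0 : 0 ≤ L := le_trans (div_nonneg (Real.log_nonneg (by linarith)) (by norm_num)) hL
  have h1 : ∫ t in (-r)..(-(r / 2)), Real.sin (Real.pi * t) ^ 2 * L ≤
      ∫ t in (-r)..(-(r / 2)), ‖sinDigamma t‖ := by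
    refine intervalIntegral.integral_mono_on (by linarith)
      (Continuous.intervalIntegrable (by fun_prop) _ _) (hcont.intervalIntegrable _ _) ?_
    intro t ht
    have hlogt : Real.log (r / 2) ≤ Real.log (-t) :=
      Real.log_le_log (by linarith) (by linarith [ht.2])
    have h := sin_sq_mul_le_norm_sinDigamma (s := -t) (by linarith [ht.2])
      (by simp only [L] at hL0; linarith)
    rw [neg_neg] at h
    refine le_trans (mul_le_mul_of_nonneg_left ?_ (sq_nonneg _)) h
    simp only [L]
    linarith
  have h2 : ∫ t in (-r)..(-(r / 2)), ‖sinDigamma t‖ ≤ ∫ t in (-r)..0, ‖sinDigamma t‖ := by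
    refine intervalIntegral.integral_mono_interval le_rfl (by linarith) (by linarith)
      (Eventually.of_forall fun t => norm_nonneg _) (hcont.intervalIntegrable _ _)
  rw [intervalIntegral.integral_mul_const] at h1
  have h3 := integral_sin_pi_sq_ge (a := -r) (b := -(r / 2))
  have h4 : r / 8 ≤ ∫ t in (-r)..(-(r / 2)), Real.sin (Real.pi * t) ^ 2 := by linarith
  have h5 : r / 8 * (Real.log r / 8) ≤ ∫ t in (-r)..0, ‖sinDigamma t‖ := by
    refine le_trans ?_ (h1.trans h2)
    exact mul_le_mul h4 hL (div_nonneg (Real.log_nonneg (by linarith)) (by norm_num))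
      (le_trans (by positivity) h4)
  rw [one_div_mul_eq_div r, le_div_iff₀ hr0]
  linarith

lemma not_bddAbove_average :
    ¬ BddAbove ((fun r : ℝ => 1 / (2 * r) * ∫ t in (-r)..r, ‖sinDigamma t‖) '' Set.Ioi 0) := by
  rintro ⟨M, hM⟩
  obtain ⟨C, hC, hlog⟩ := exists_log_le_average
  obtain ⟨r, h1, h2, h3⟩ := (hlog.and ((eventually_gt_atTop 0).and
    (Real.tendsto_log_atTop.eventually_gt_atTop (2 * M / C)))).exists
  have hcont : Continuous fun t : ℝ => ‖sinDigamma t‖ :=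
    (differentiable_sinDigamma.continuous.comp Complex.continuous_ofReal).norm
  have h4 : ∫ t in (-r)..0, ‖sinDigamma t‖ ≤ ∫ t in (-r)..r, ‖sinDigamma t‖ :=
    intervalIntegral.integral_mono_interval le_rfl (by linarith) h2.le
      (Eventually.of_forall fun t => norm_nonneg _) (hcont.intervalIntegrable _ _)
  have h5 : 1 / (2 * r) * ∫ t in (-r)..r, ‖sinDigamma t‖ ≤ M := hM ⟨r, h2, rfl⟩
  rw [one_div_mul_eq_div, div_le_iff₀ (by linarith)] at h5
  rw [one_div_mul_eq_div, le_div_iff₀ h2] at h1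
  rw [div_lt_iff₀ hC] at h3
  nlinarith

/-! ### Vanishing of a tempered distribution off its support -/

/-- The support is defined locally; compactness and a smooth partition of unity split `u` into
finitely many pieces, each supported in an open set where `T` vanishes. -/
lemma apply_eq_zero_of_disjoint_dsupport {T : 𝓢'(ℝ, ℂ)} {u : 𝓢(ℝ, ℂ)}
    (hc : HasCompactSupport u) (hd : Disjoint (tsupport u) (Distribution.dsupport T)) :
    T u = 0 := by
  have hloc : ∀ x : ℝ, ∃ s : Set ℝ, IsOpen s ∧
      (x ∈ tsupport u → x ∈ s ∧ Distribution.IsVanishingOn T s) := by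
    intro x
    by_cases hx : x ∈ tsupport u
    · obtain ⟨s, h1, h2, h3⟩ :=
        (Distribution.notMem_dsupport_iff x).1 (Set.disjoint_left.1 hd hx)
      exact ⟨s, h2, fun _ => ⟨h3, h1⟩⟩
    · exact ⟨∅, isOpen_empty, fun h => absurd h hx⟩
  choose U hUo hU using hloc
  obtain ⟨t, ht, hcover⟩ := hc.isCompact.elim_nhds_subcover U
    fun x hx => (hUo x).mem_nhds (hU x hx).1
  obtain ⟨ρ, hρ⟩ := SmoothPartitionOfUnity.exists_isSubordinate (modelWithCornersSelf ℝ ℝ)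
    (isClosed_tsupport u) (fun i : t => U i) (fun i => hUo i)
    (fun x hx => by
      obtain ⟨i, hi, hxi⟩ := Set.mem_iUnion₂.1 (hcover hx)
      exact Set.mem_iUnion.2 ⟨⟨i, hi⟩, hxi⟩)
  have hsm : ∀ i : t, ContDiff ℝ (↑(⊤ : ℕ∞)) fun x => ((ρ i x : ℝ) : ℂ) * u x := fun i =>
    (Complex.ofRealCLM.contDiff.comp (contMDiff_iff_contDiff.1 (ρ i).contMDiff)).mul (u.smooth _)
  have hcs : ∀ i : t, HasCompactSupport fun x => ((ρ i x : ℝ) : ℂ) * u x := fun i => hc.mul_left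
  have hu : u = ∑ i : t, (hcs i).toSchwartzMap (hsm i) := by
    ext x
    rw [sum_apply]
    simp only [HasCompactSupport.toSchwartzMap_toFun]
    rw [← Finset.sum_mul, ← Complex.ofReal_sum]
    by_cases hx : x ∈ tsupport u
    · have h := ρ.sum_eq_one hx
      rw [finsum_eq_sum_of_fintype] at h
      rw [h, Complex.ofReal_one, one_mul]
    · rw [image_eq_zero_of_notMem_tsupport hx, mul_zero]
  rw [hu, map_sum]
  refine Finset.sum_eq_zero fun i _ => (hU i (ht i i.2)).2 _ ?_
  refine subset_trans ?_ (hρ i)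
  refine closure_mono fun x hx => ?_
  simp only [Function.mem_support, HasCompactSupport.toSchwartzMap_toFun] at hx ⊢
  exact fun h => hx (by rw [h, Complex.ofReal_zero, zero_mul])

/-! ### Fourier transforms of test functions -/

/-- The spectrum of the function `g` is contained in `[-b/2, b/2]`. -/
def HasSpectrumIn (b : ℝ) (g : ℝ → ℂ) : Prop :=
  ∀ q : ℝ → ℂ, HasCompactSupport q → ContDiff ℝ (↑(⊤ : ℕ∞)) q →
    Disjoint (tsupport q) (Set.Icc (-(b / 2)) (b / 2)) → ∫ x, 𝓕 q x * g x = 0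

lemma hasSpectrumIn_of_mem_paleyWiener {b : ℝ} {f : Lp ℂ ⊤ (volume : Measure ℝ)} {g : ℝ → ℂ}
    (hf : f ∈ PaleyWiener b ⊤) (hfg : f =ᵐ[volume] g) : HasSpectrumIn b g := by
  intro q hq hs hd
  have h := apply_eq_zero_of_disjoint_dsupport (T := 𝓕 (Lp.toTemperedDistribution f : 𝓢'(ℝ, ℂ)))
    (u := hq.toSchwartzMap hs) hq (hd.mono_right hf)
  rw [TemperedDistribution.fourier_apply, Lp.toTemperedDistribution_apply] at h
  rw [← h]
  refine integral_congr_ae ?_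
  filter_upwards [hfg] with x hx
  rw [SchwartzMap.fourier_coe, hx]
  rfl

/-- The set where a continuous `g` exceeds the essential bound is open and null, hence empty. -/
lemma exists_norm_le_of_ae_eq_Lp_top {f : Lp ℂ ⊤ (volume : Measure ℝ)} {g : ℝ → ℂ}
    (hg : Continuous g) (hfg : f =ᵐ[volume] g) : ∃ M, 0 ≤ M ∧ ∀ x, ‖g x‖ ≤ M := by
  refine ⟨‖f‖, norm_nonneg _, fun x => ?_⟩
  have hae : ∀ᵐ x, ‖g x‖ ≤ ‖f‖ := by
    filter_upwards [hfg, ae_le_eLpNormEssSup (f := f) (μ := volume)] with x hx h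
    rw [← hx, Lp.norm_def, eLpNorm_exponent_top, ← toReal_enorm]
    exact ENNReal.toReal_mono (by rw [← eLpNorm_exponent_top]; exact Lp.eLpNorm_ne_top f) h
  have hU : IsOpen {x | ‖f‖ < ‖g x‖} := isOpen_lt continuous_const hg.norm
  have h0 : volume {x | ‖f‖ < ‖g x‖} = 0 := by
    simpa only [ae_iff, not_le] using hae
  have hempty := hU.eq_empty_of_measure_zero h0
  exact not_lt.1 fun h => (Set.eq_empty_iff_forall_notMem.1 hempty) x h

lemma fourier_comp_sub_right (q : ℝ → ℂ) (c x : ℝ) :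
    𝓕 (fun v => q (v - c)) x = Complex.exp ((-2 * Real.pi * c * x : ℝ) * Complex.I) * 𝓕 q x := by
  rw [Real.fourier_real_eq_integral_exp_smul, Real.fourier_real_eq_integral_exp_smul,
    ← integral_const_mul, ← integral_add_right_eq_self _ c]
  refine integral_congr_ae (Eventually.of_forall fun v => ?_)
  simp only [smul_eq_mul, add_sub_cancel_right]
  rw [← mul_assoc, ← Complex.exp_add]
  congr 2
  push_cast
  ring

lemma fourier_comp_div {δ : ℝ} (hδ : 0 < δ) (q : ℝ → ℂ) (x : ℝ) :
    𝓕 (fun v => q (v / δ)) x = δ * 𝓕 q (δ * x) := by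
  rw [Real.fourier_real_eq_integral_exp_smul, Real.fourier_real_eq_integral_exp_smul]
  have h := Measure.integral_comp_div
    (fun v => Complex.exp ((-2 * Real.pi * v * (δ * x) : ℝ) * Complex.I) • q v) δ
  rw [abs_of_pos hδ] at h
  rw [← Complex.real_smul, ← h]
  refine integral_congr_ae (Eventually.of_forall fun v => ?_)
  simp only
  congr 4
  field_simp

lemma continuous_fourier_of_contDiff {q : ℝ → ℂ} (hq : HasCompactSupport q)
    (hs : ContDiff ℝ (↑(⊤ : ℕ∞)) q) : Continuous (𝓕 q) := by
  have h := (𝓕 (hq.toSchwartzMap hs)).continuous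
  rwa [SchwartzMap.fourier_coe] at h

lemma integrable_fourier_of_contDiff {q : ℝ → ℂ} (hq : HasCompactSupport q)
    (hs : ContDiff ℝ (↑(⊤ : ℕ∞)) q) : Integrable (𝓕 q) := by
  have h := (𝓕 (hq.toSchwartzMap hs)).integrable (μ := volume)
  rwa [SchwartzMap.fourier_coe] at h

lemma isBigO_fourier_of_contDiff {q : ℝ → ℂ} (hq : HasCompactSupport q)
    (hs : ContDiff ℝ (↑(⊤ : ℕ∞)) q) :
    𝓕 q =O[cocompact ℝ] fun x : ℝ => |x| ^ (-2 : ℝ) := by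
  have h := (𝓕 (hq.toSchwartzMap hs)).isBigO_cocompact_rpow (-2)
  rwa [SchwartzMap.fourier_coe] at h

lemma tsupport_comp_sub_right_subset {q : ℝ → ℂ} {a b : ℝ} (c : ℝ)
    (h : tsupport q ⊆ Set.Icc a b) :
    tsupport (fun v => q (v - c)) ⊆ Set.Icc (a + c) (b + c) := by
  refine closure_minimal (fun v hv => ?_) isClosed_Icc
  have := h (subset_tsupport q hv)
  exact ⟨by linarith [this.1], by linarith [this.2]⟩

lemma hasCompactSupport_of_tsupport_subset_Icc {q : ℝ → ℂ} {a b : ℝ}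
    (h : tsupport q ⊆ Set.Icc a b) : HasCompactSupport q :=
  isCompact_Icc.of_isClosed_subset (isClosed_tsupport q) h

/-! ### Sampling at the critical rate -/

/-- Poisson summation for `𝓕 q₁ · g`, where the shift by `1/2` supplies the signs `(-1)^k`. The dual
side pairs `g` with integer translates of `q₁`, and a single one meets the spectrum. -/
lemma hasSum_alternating_sampling {g : ℝ → ℂ} (hg : Continuous g) {M : ℝ} (hM : ∀ x, ‖g x‖ ≤ M)
    (hspec : HasSpectrumIn 1 g) {q : ℝ → ℂ} (hs : ContDiff ℝ (↑(⊤ : ℕ∞)) q) {a b : ℝ}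
    (ha : 0 < a) (hb : b < 1) (hsupp : tsupport q ⊆ Set.Icc a b) :
    HasSum (fun k : ℤ => (-1) ^ k * 𝓕 q k * g k)
      (∫ x, Complex.exp ((Real.pi * x : ℝ) * Complex.I) * 𝓕 q x * g x) := by
  set q₁ : ℝ → ℂ := fun v => q (v - 1 / 2) with hq₁
  have hs₁ : ContDiff ℝ (↑(⊤ : ℕ∞)) q₁ := hs.comp (contDiff_id.sub contDiff_const)
  have hsupp₁ : tsupport q₁ ⊆ Set.Icc (a + 1 / 2) (b + 1 / 2) :=
    tsupport_comp_sub_right_subset _ hsupp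
  have hc₁ := hasCompactSupport_of_tsupport_subset_Icc hsupp₁
  set h : ℝ → ℂ := fun x => 𝓕 q₁ x * g x with hh
  have hcont : Continuous h := (continuous_fourier_of_contDiff hc₁ hs₁).mul hg
  have hbig : h =O[cocompact ℝ] fun x : ℝ => |x| ^ (-2 : ℝ) := by
    have hgb : g =O[cocompact ℝ] fun _ : ℝ => (1 : ℝ) :=
      Asymptotics.IsBigO.of_bound M (Eventually.of_forall fun x => by simpa using hM x)
    simpa using (isBigO_fourier_of_contDiff hc₁ hs₁).mul hgb
  have hF : ∀ m : ℝ, 𝓕 h m = ∫ x, 𝓕 (fun v => q₁ (v - m)) x * g x := by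
    intro m
    rw [Real.fourier_real_eq_integral_exp_smul]
    refine integral_congr_ae (Eventually.of_forall fun x => ?_)
    simp only [smul_eq_mul, hh]
    rw [fourier_comp_sub_right q₁ m x, ← mul_assoc]
    congr 4
    push_cast
    ring
  -- The translate by `m` is supported strictly inside `(m + 1/2, m + 3/2)`, which misses `[-1/2,
  -- 1/2]` unless `m = -1`.
  have hzero : ∀ m : ℤ, m ≠ -1 → 𝓕 h m = 0 := by
    intro m hm
    have hsm := tsupport_comp_sub_right_subset (m : ℝ) hsupp₁
    rw [hF]
    refine hspec _ (hasCompactSupport_of_tsupport_subset_Icc hsm)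
      (hs₁.comp (contDiff_id.sub contDiff_const)) (Set.disjoint_left.2 fun v hv hv' => hm ?_)
    have h1 := hsm hv
    have h2 : (m : ℝ) < 0 := by linarith [h1.1, hv'.2]
    have h3 : (-2 : ℝ) < m := by linarith [h1.2, hv'.1]
    have h2' : m < 0 := by exact_mod_cast h2
    have h3' : -2 < m := by exact_mod_cast h3
    omega
  have hsumF : HasSum (fun m : ℤ => 𝓕 h m) (𝓕 h (-1 : ℤ)) :=
    hasSum_single _ hzero
  have hP := Real.tsum_eq_tsum_fourier_of_rpow_decay_of_summable hcont one_lt_two hbig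
    hsumF.summable 0
  simp only [zero_add, QuotientAddGroup.mk_zero, fourier_eval_zero, mul_one] at hP
  rw [hsumF.tsum_eq] at hP
  have hsum : Summable fun k : ℤ => h k :=
    summable_of_isBigO (Real.summable_abs_int_rpow one_lt_two)
      (hbig.comp_tendsto Int.tendsto_coe_cofinite)
  have hval : 𝓕 h (-1 : ℤ) =
      ∫ x, Complex.exp ((Real.pi * x : ℝ) * Complex.I) * 𝓕 q x * g x := by
    rw [hF]
    refine integral_congr_ae (Eventually.of_forall fun x => ?_)
    simp only
    rw [fourier_comp_sub_right q₁, hq₁, fourier_comp_sub_right q, ← mul_assoc, ← Complex.exp_add]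
    congr 3
    push_cast
    ring
  rw [← hval, ← hP]
  convert hsum.hasSum using 2 with k
  rw [hh]
  simp only
  rw [hq₁, fourier_comp_sub_right q]
  congr 2
  rw [← cos_pi_intCast, Complex.exp_mul_I]
  have h1 : ((-2 * Real.pi * (1 / 2) * k : ℝ) : ℂ) = -(Real.pi * k) := by push_cast; ring
  rw [h1, Complex.cos_neg, Complex.sin_neg, sin_pi_intCast]
  simp

/-- The multiplier is `1/(1 - e^{-2πiv}) = 1/2 - (i/2) cot(πv)`, regular on the support of `q`. With
`p` the product, `𝓕q(k) = 𝓕p(k) - 𝓕p(k+1)`, so the sum telescopes and Riemann–Lebesgue removes the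
tail. -/
lemma tendsto_sum_fourier_nat {q : ℝ → ℝ} (hq : Continuous q) {a b : ℝ} (ha : 0 < a) (hb : b < 1)
    (hsupp : tsupport q ⊆ Set.Icc a b) :
    Integrable (fun v : ℝ => (q v : ℂ) *
      (1 / 2 - Real.cos (Real.pi * v) / (2 * Real.sin (Real.pi * v)) * Complex.I)) ∧
    Tendsto (fun N : ℕ => ∑ k ∈ Finset.range N, 𝓕 (fun v => (q v : ℂ)) k) atTop
      (𝓝 (∫ v : ℝ, (q v : ℂ) *
        (1 / 2 - Real.cos (Real.pi * v) / (2 * Real.sin (Real.pi * v)) * Complex.I))) := by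
  set p : ℝ → ℂ := fun v : ℝ => (q v : ℂ) *
    (1 / 2 - Real.cos (Real.pi * v) / (2 * Real.sin (Real.pi * v)) * Complex.I) with hp
  have hsin : ∀ v ∈ Set.Icc a b, Real.sin (Real.pi * v) ≠ 0 := fun v hv =>
    (Real.sin_pos_of_pos_of_lt_pi (mul_pos Real.pi_pos (by linarith [hv.1]))
      (by nlinarith [Real.pi_pos, hv.2])).ne'
  have hsp : Function.support p ⊆ Function.support q := fun v hv h => hv (by
    simp [hp, h])
  have htp : tsupport p ⊆ Set.Icc a b := (closure_mono hsp).trans hsupp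
  have hpc : Continuous p := by
    refine continuous_of_tsupport fun v hv => ?_
    have h0 := hsin v (htp hv)
    have h0' : (2 * (Real.sin (Real.pi * v) : ℂ)) ≠ 0 :=
      mul_ne_zero two_ne_zero (by exact_mod_cast h0)
    refine (Complex.continuous_ofReal.comp hq).continuousAt.mul
      (continuousAt_const.sub (ContinuousAt.mul (ContinuousAt.div ?_ ?_ h0') continuousAt_const))
    · exact Continuous.continuousAt (by fun_prop)
    · exact Continuous.continuousAt (by fun_prop)
  have hpi : Integrable p :=
    hpc.integrable_of_hasCompactSupport (hasCompactSupport_of_tsupport_subset_Icc htp)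
  refine ⟨hpi, ?_⟩
  have hmul : ∀ v : ℝ, (1 - Complex.exp ((-2 * Real.pi * v : ℝ) * Complex.I)) * p v = q v := by
    intro v
    by_cases hv : q v = 0
    · simp [hp, hv]
    have h0 := hsin v (hsupp (subset_tsupport q hv))
    have h0' : (Real.sin (Real.pi * v) : ℂ) ≠ 0 := by exact_mod_cast h0
    have hexp : Complex.exp ((-2 * Real.pi * v : ℝ) * Complex.I) =
        (1 - 2 * Real.sin (Real.pi * v) ^ 2) -
          2 * Real.sin (Real.pi * v) * Real.cos (Real.pi * v) * Complex.I := by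
      rw [Complex.exp_mul_I, ← Complex.ofReal_cos, ← Complex.ofReal_sin,
        show -2 * Real.pi * v = -(2 * (Real.pi * v)) by ring, Real.cos_neg, Real.sin_neg,
        Real.sin_two_mul, Real.cos_two_mul, Real.cos_sq']
      push_cast
      ring
    have hsc : (Real.sin (Real.pi * v) : ℂ) ^ 2 + (Real.cos (Real.pi * v) : ℂ) ^ 2 = 1 := by
      exact_mod_cast Real.sin_sq_add_cos_sq (Real.pi * v)
    have key : ∀ s c Q : ℂ, s ≠ 0 → s ^ 2 + c ^ 2 = 1 →
        (1 - (1 - 2 * s ^ 2 - 2 * s * c * Complex.I)) *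
          (Q * (1 / 2 - c / (2 * s) * Complex.I)) = Q := by
      intro s c Q hs hsc
      have h1 : c / (2 * s) * s = c / 2 := by field_simp
      linear_combination Q * hsc - 2 * Q * Complex.I * (s + c * Complex.I) * h1 -
        Q * c ^ 2 * Complex.I_sq
    rw [hexp]
    exact key _ _ _ h0' hsc
  have hstep : ∀ k : ℕ, 𝓕 (fun v => (q v : ℂ)) k = 𝓕 p k - 𝓕 p (k + 1 : ℕ) := by
    intro k
    have hint : ∀ x : ℝ, Integrable fun v : ℝ =>
        Complex.exp ((-2 * Real.pi * v * x : ℝ) * Complex.I) • p v := fun x => by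
      have := (Real.fourierIntegral_convergent_iff (μ := volume) (f := p) x).2 hpi
      refine this.congr (Eventually.of_forall fun v => ?_)
      simp only [Circle.smul_def, Real.fourierChar_apply]
      congr 3
      simp
      ring
    rw [Real.fourier_real_eq_integral_exp_smul, Real.fourier_real_eq_integral_exp_smul,
      Real.fourier_real_eq_integral_exp_smul, ← integral_sub (hint _) (hint _)]
    refine integral_congr_ae (Eventually.of_forall fun v => ?_)
    simp only [smul_eq_mul]
    rw [← hmul v]
    have : ((-2 * Real.pi * v * ((k + 1 : ℕ) : ℝ) : ℝ) : ℂ) * Complex.I =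
        (-2 * Real.pi * v * (k : ℝ) : ℝ) * Complex.I + (-2 * Real.pi * v : ℝ) * Complex.I := by
      push_cast; ring
    rw [this, Complex.exp_add]
    ring
  have htel : ∀ N : ℕ, ∑ k ∈ Finset.range N, 𝓕 (fun v => (q v : ℂ)) k = 𝓕 p (0 : ℕ) - 𝓕 p N := by
    intro N
    simp_rw [hstep]
    exact Finset.sum_range_sub' (fun k : ℕ => 𝓕 p k) N
  have h0 : 𝓕 p (0 : ℕ) = ∫ v, p v := by
    rw [Real.fourier_real_eq_integral_exp_smul]
    simp
  simp_rw [htel, h0]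
  have hRL : Tendsto (fun N : ℕ => 𝓕 p N) atTop (𝓝 0) :=
    (Real.zero_at_infty_fourier p).comp
      (tendsto_natCast_atTop_atTop.mono_right atTop_le_cocompact)
  simpa using hRL.const_sub (∫ v, p v)

/-! ### Test functions with one-sided spectrum -/

/-- A smooth cutoff, equal to `1` on `[-1/8, 1/8]` and supported in `[-1/4, 1/4]`. -/
def lowPass : ContDiffBump (0 : ℝ) := ⟨1 / 8, 1 / 4, by norm_num, by norm_num⟩

lemma lowPass_eq_one {x : ℝ} (h : |x| ≤ 1 / 8) : lowPass x = 1 :=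
  lowPass.one_of_mem_closedBall (by simpa [lowPass] using h)

lemma lowPass_eq_zero {x : ℝ} (h : 1 / 4 ≤ |x|) : lowPass x = 0 :=
  lowPass.zero_of_le_dist (by simpa [lowPass] using h)

/-- The band-pass profile, equal to `1` for `δ/4 ≤ |x| ≤ 1/8` and to `0` for `|x| ≤ δ/8`. -/
def bandPass (δ x : ℝ) : ℝ := lowPass x - lowPass (x / δ)

/-- The part of the band-pass profile on the positive half-line. -/
def posBand (δ x : ℝ) : ℝ := Real.smoothTransition (8 * x / δ) * bandPass δ x

/-- The part of the band-pass profile on the negative half-line. -/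
def negBand (δ x : ℝ) : ℝ := bandPass δ x - posBand δ x

lemma contDiff_bandPass (δ : ℝ) : ContDiff ℝ (↑(⊤ : ℕ∞)) (bandPass δ) :=
  lowPass.contDiff.sub (lowPass.contDiff.comp (contDiff_id.div_const δ))

lemma contDiff_posBand (δ : ℝ) : ContDiff ℝ (↑(⊤ : ℕ∞)) (posBand δ) :=
  (Real.smoothTransition.contDiff.comp ((contDiff_const.mul contDiff_id).div_const δ)).mul
    (contDiff_bandPass δ)

lemma contDiff_negBand (δ : ℝ) : ContDiff ℝ (↑(⊤ : ℕ∞)) (negBand δ) :=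
  (contDiff_bandPass δ).sub (contDiff_posBand δ)

section Band

variable {δ : ℝ}

lemma bandPass_eq_zero_of_le {x : ℝ} (hδ : 0 < δ) (hδ' : δ ≤ 1 / 2) (h : |x| ≤ δ / 8) :
    bandPass δ x = 0 := by
  rw [bandPass, lowPass_eq_one (by linarith), lowPass_eq_one, sub_self]
  rw [abs_div, abs_of_pos hδ, div_le_iff₀ hδ]
  linarith

lemma bandPass_eq_zero_of_ge {x : ℝ} (hδ : 0 < δ) (hδ' : δ ≤ 1 / 2) (h : 1 / 4 ≤ |x|) :
    bandPass δ x = 0 := by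
  rw [bandPass, lowPass_eq_zero h, lowPass_eq_zero, sub_self]
  rw [abs_div, abs_of_pos hδ, le_div_iff₀ hδ]
  linarith

lemma bandPass_nonneg (hδ : 0 < δ) (hδ' : δ ≤ 1 / 2) (x : ℝ) : 0 ≤ bandPass δ x := by
  rcases le_total |x| (1 / 8) with h | h
  · rw [bandPass, lowPass_eq_one h]
    linarith [lowPass.le_one (x := x / δ)]
  · rw [bandPass, lowPass_eq_zero (x := x / δ), sub_zero]
    · exact lowPass.nonneg
    · rw [abs_div, abs_of_pos hδ, le_div_iff₀ hδ]
      linarith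

lemma bandPass_eq_one {x : ℝ} (hδ : 0 < δ) (h1 : δ / 4 ≤ |x|) (h2 : |x| ≤ 1 / 8) :
    bandPass δ x = 1 := by
  rw [bandPass, lowPass_eq_one h2, lowPass_eq_zero, sub_zero]
  rw [abs_div, abs_of_pos hδ, le_div_iff₀ hδ]
  linarith

lemma posBand_eq_bandPass {x : ℝ} (hδ : 0 < δ) (hx : δ / 8 ≤ x) : posBand δ x = bandPass δ x := by
  rw [posBand, Real.smoothTransition.one_of_one_le, one_mul]
  rw [le_div_iff₀ hδ]
  linarith

/-- The smooth transition takes place on `[0, δ/8]`, where the band-pass profile already vanishes,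
so the cut at the origin loses no smoothness. -/
lemma posBand_eq_zero {x : ℝ} (hδ : 0 < δ) (hδ' : δ ≤ 1 / 2) (hx : x ≤ δ / 8) :
    posBand δ x = 0 := by
  rcases le_total x 0 with h | h
  · rw [posBand, Real.smoothTransition.zero_of_nonpos, zero_mul]
    exact div_nonpos_of_nonpos_of_nonneg (by linarith) hδ.le
  · rw [posBand, bandPass_eq_zero_of_le hδ hδ' (by rwa [abs_of_nonneg h]), mul_zero]

lemma posBand_nonneg (hδ : 0 < δ) (hδ' : δ ≤ 1 / 2) (x : ℝ) : 0 ≤ posBand δ x :=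
  mul_nonneg (Real.smoothTransition.nonneg _) (bandPass_nonneg hδ hδ' x)

lemma tsupport_bandPass_subset (hδ : 0 < δ) (hδ' : δ ≤ 1 / 2) :
    tsupport (bandPass δ) ⊆ Set.Icc (-(1 / 4)) (1 / 4) := by
  refine closure_minimal (fun x hx => abs_le.1 ?_) isClosed_Icc
  exact not_lt.1 fun h => hx (bandPass_eq_zero_of_ge hδ hδ' h.le)

lemma tsupport_posBand_subset (hδ : 0 < δ) (hδ' : δ ≤ 1 / 2) :
    tsupport (posBand δ) ⊆ Set.Icc (δ / 8) (1 / 4) := by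
  refine closure_minimal (fun x hx => ⟨?_, ?_⟩) isClosed_Icc
  · exact not_lt.1 fun h => hx (posBand_eq_zero hδ hδ' h.le)
  · refine not_lt.1 fun h => hx ?_
    rw [posBand, bandPass_eq_zero_of_ge hδ hδ' (h.le.trans (le_abs_self x)), mul_zero]

lemma tsupport_negBand_subset (hδ : 0 < δ) (hδ' : δ ≤ 1 / 2) :
    tsupport (negBand δ) ⊆ Set.Icc (-(1 / 4)) (-(δ / 8)) := by
  refine closure_minimal (fun x hx => ⟨?_, ?_⟩) isClosed_Icc
  · refine not_lt.1 fun h => hx ?_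
    have hx' : 1 / 4 ≤ |x| := by linarith [neg_le_abs x]
    rw [negBand, posBand, bandPass_eq_zero_of_ge hδ hδ' hx', mul_zero, sub_zero]
  · refine not_lt.1 fun h => hx ?_
    rcases le_total x (δ / 8) with h1 | h1
    · rw [negBand, posBand_eq_zero hδ hδ' h1,
        bandPass_eq_zero_of_le hδ hδ' (abs_le.2 ⟨h.le, h1⟩), sub_zero]
    · rw [negBand, posBand_eq_bandPass hδ h1, sub_self]

end Band

lemma tsupport_ofReal_subset (q : ℝ → ℝ) : tsupport (fun v => (q v : ℂ)) ⊆ tsupport q :=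
  closure_mono fun v hv h => hv (by simp [h])

lemma hasCompactSupport_lowPass : HasCompactSupport fun v : ℝ => (lowPass v : ℂ) :=
  lowPass.hasCompactSupport.comp_left (g := Complex.ofReal) rfl

lemma contDiff_ofReal_comp {q : ℝ → ℝ} (h : ContDiff ℝ (↑(⊤ : ℕ∞)) q) :
    ContDiff ℝ (↑(⊤ : ℕ∞)) fun v => (q v : ℂ) :=
  Complex.ofRealCLM.contDiff.comp h

/-- The `L¹` norm of the Fourier transform of the cutoff. -/
def lowPassNorm : ℝ := ∫ x, ‖𝓕 (fun v : ℝ => (lowPass v : ℂ)) x‖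

lemma fourier_sub_apply {f g : ℝ → ℂ} (hf : Integrable f) (hg : Integrable g) (x : ℝ) :
    𝓕 (fun v => f v - g v) x = 𝓕 f x - 𝓕 g x := by
  have hint : ∀ {h : ℝ → ℂ}, Integrable h → Integrable fun v => Real.fourierChar (-(v * x)) • h v :=
    fun hh => by
      simpa [mul_comm] using (Real.fourierIntegral_convergent_iff (μ := volume) x).2 hh
  rw [Real.fourier_real_eq, Real.fourier_real_eq, Real.fourier_real_eq,
    ← integral_sub (hint hf) (hint hg)]
  simp only [smul_sub]

lemma fourier_bandPass {δ : ℝ} (hδ : 0 < δ) (x : ℝ) :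
    𝓕 (fun v => (bandPass δ v : ℂ)) x = 𝓕 (fun v : ℝ => (lowPass v : ℂ)) x -
      δ * 𝓕 (fun v : ℝ => (lowPass v : ℂ)) (δ * x) := by
  have hi : Integrable fun v : ℝ => (lowPass v : ℂ) :=
    (contDiff_ofReal_comp lowPass.contDiff).continuous.integrable_of_hasCompactSupport
      hasCompactSupport_lowPass
  have hi' : Integrable fun v : ℝ => (lowPass (v / δ) : ℂ) := hi.comp_div hδ.ne'
  rw [← fourier_comp_div hδ (fun v : ℝ => (lowPass v : ℂ)) x, ← fourier_sub_apply hi hi']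
  simp only [bandPass, Complex.ofReal_sub]

/-- Dilating the bump replaces its transform `F` by `δ F(δx)`, which has the same `L¹` norm.
Uniformity in `δ` is the point; no such bound is available for the one-sided profile. -/
lemma integral_norm_fourier_bandPass_le {δ : ℝ} (hδ : 0 < δ) :
    Integrable (𝓕 fun v => (bandPass δ v : ℂ)) ∧
      ∫ x, ‖𝓕 (fun v => (bandPass δ v : ℂ)) x‖ ≤ 2 * lowPassNorm := by
  have hi : Integrable (𝓕 fun v : ℝ => (lowPass v : ℂ)) :=
    integrable_fourier_of_contDiff hasCompactSupport_lowPass (contDiff_ofReal_comp lowPass.contDiff)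
  have hi' : Integrable fun x : ℝ => (δ : ℂ) * 𝓕 (fun v : ℝ => (lowPass v : ℂ)) (δ * x) :=
    (hi.comp_mul_left' hδ.ne').const_mul _
  have heq : (𝓕 fun v => (bandPass δ v : ℂ)) = fun x => 𝓕 (fun v : ℝ => (lowPass v : ℂ)) x -
      δ * 𝓕 (fun v : ℝ => (lowPass v : ℂ)) (δ * x) := funext (fourier_bandPass hδ)
  rw [heq]
  refine ⟨hi.sub hi', ?_⟩
  have hscale : ∫ x, ‖(δ : ℂ) * 𝓕 (fun v : ℝ => (lowPass v : ℂ)) (δ * x)‖ = lowPassNorm := by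
    simp_rw [norm_mul, Complex.norm_real, Real.norm_of_nonneg hδ.le]
    rw [integral_const_mul, Measure.integral_comp_mul_left
      (fun y => ‖𝓕 (fun v : ℝ => (lowPass v : ℂ)) y‖) δ, abs_of_pos (inv_pos.2 hδ), smul_eq_mul,
      mul_inv_cancel_left₀ hδ.ne', lowPassNorm]
  calc _ ≤ ∫ x, (‖𝓕 (fun v : ℝ => (lowPass v : ℂ)) x‖ +
        ‖(δ : ℂ) * 𝓕 (fun v : ℝ => (lowPass v : ℂ)) (δ * x)‖) :=
        integral_mono (hi.sub hi').norm (hi.norm.add hi'.norm) fun x => norm_sub_le _ _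
    _ = 2 * lowPassNorm := by
      rw [integral_add hi.norm hi'.norm, hscale, ← lowPassNorm, two_mul]

/-! ### No bounded bandlimited function has the step samples -/

/-- On `[δ/4, 1/8]` the profile is 1, `cos(πv) ≥ 1/2` and `sin(πv) ≤ πv`, so the integrand is at
least `1/(4πv)`. -/
lemma log_le_integral_posBand_cot {δ : ℝ} (hδ : 0 < δ) (hδ' : δ ≤ 1 / 2)
    (hi : Integrable fun v : ℝ => posBand δ v *
      (Real.cos (Real.pi * v) / (2 * Real.sin (Real.pi * v)))) :
    Real.log (1 / (2 * δ)) / (4 * Real.pi) ≤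
      ∫ v, posBand δ v * (Real.cos (Real.pi * v) / (2 * Real.sin (Real.pi * v))) := by
  have hle : δ / 4 ≤ 1 / 8 := by linarith
  have hint : Real.log (1 / (2 * δ)) / (4 * Real.pi) =
      ∫ v in Set.Ioc (δ / 4) (1 / 8), 1 / (4 * Real.pi) * (1 / v) := by
    rw [← intervalIntegral.integral_of_le hle, intervalIntegral.integral_const_mul,
      integral_one_div_of_pos (by linarith) (by norm_num)]
    rw [show (1 / 8 : ℝ) / (δ / 4) = 1 / (2 * δ) by field_simp; norm_num]
    ring
  have hnn : ∀ v, 0 ≤ posBand δ v * (Real.cos (Real.pi * v) / (2 * Real.sin (Real.pi * v))) := by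
    intro v
    by_cases hv : posBand δ v = 0
    · rw [hv, zero_mul]
    have hmem := tsupport_posBand_subset hδ hδ' (subset_tsupport _ hv)
    have hv0 : 0 < v := by linarith [hmem.1]
    refine mul_nonneg (posBand_nonneg hδ hδ' v) (div_nonneg ?_ (mul_nonneg zero_le_two ?_))
    · exact Real.cos_nonneg_of_mem_Icc ⟨by nlinarith [Real.pi_pos], by nlinarith [Real.pi_pos, hmem.2]⟩
    · exact Real.sin_nonneg_of_nonneg_of_le_pi (by positivity) (by nlinarith [Real.pi_pos, hmem.2])
  rw [hint]
  refine le_trans ?_ (setIntegral_le_integral (s := Set.Ioc (δ / 4) (1 / 8)) hi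
    (Eventually.of_forall hnn))
  refine setIntegral_mono_on ?_ hi.integrableOn measurableSet_Ioc fun v hv => ?_
  · refine (ContinuousOn.integrableOn_Icc ?_).mono_set Set.Ioc_subset_Icc_self
    refine continuousOn_const.mul (continuousOn_const.div continuousOn_id fun v hv => ?_)
    exact ne_of_gt (lt_of_lt_of_le (by linarith) hv.1)
  · have hv0 : 0 < v := by linarith [hv.1]
    have hπ := Real.pi_pos
    rw [posBand_eq_bandPass hδ (by linarith [hv.1]), bandPass_eq_one hδ
      (by rw [abs_of_pos hv0]; exact hv.1.le) (by rw [abs_of_pos hv0]; exact hv.2), one_mul]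
    have hcos : 1 / 2 ≤ Real.cos (Real.pi * v) := by
      rw [← Real.cos_pi_div_three]
      exact Real.cos_le_cos_of_nonneg_of_le_pi (by positivity) (by linarith)
        (by nlinarith [hv.2])
    have hsin : Real.sin (Real.pi * v) ≤ Real.pi * v := Real.sin_le (by positivity)
    have hsin0 : 0 < Real.sin (Real.pi * v) :=
      Real.sin_pos_of_pos_of_lt_pi (by positivity) (by nlinarith [hv.2])
    calc 1 / (4 * Real.pi) * (1 / v) = (1 / 2) / (2 * (Real.pi * v)) := by field_simp; norm_num
      _ ≤ _ := by gcongr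

theorem not_exists_step_interpolant {g : ℝ → ℂ} (hg : Continuous g) {M : ℝ} (hM0 : 0 ≤ M)
    (hM : ∀ x, ‖g x‖ ≤ M) (hspec : HasSpectrumIn 1 g) (hk : ∀ k : ℤ, g k = stepSamples k) :
    False := by
  have key : ∀ δ : ℝ, 0 < δ → δ ≤ 1 / 2 →
      Real.log (1 / (2 * δ)) / 4 ≤ M * (2 * lowPassNorm) := by
    intro δ hδ hδ'
    set q : ℝ → ℂ := fun v => (posBand δ v : ℂ)
    have hsupp : tsupport q ⊆ Set.Icc (δ / 8) (1 / 4) :=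
      (tsupport_ofReal_subset _).trans (tsupport_posBand_subset hδ hδ')
    have hs : ContDiff ℝ (↑(⊤ : ℕ∞)) q := contDiff_ofReal_comp (contDiff_posBand δ)
    have hsamp := hasSum_alternating_sampling hg hM hspec hs (by positivity) (by norm_num) hsupp
    obtain ⟨hpi, hlim⟩ := tendsto_sum_fourier_nat (contDiff_posBand δ).continuous
      (by positivity) (by norm_num) (tsupport_posBand_subset hδ hδ')
    set P := ∫ v : ℝ, (posBand δ v : ℂ) *
      (1 / 2 - Real.cos (Real.pi * v) / (2 * Real.sin (Real.pi * v)) * Complex.I)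
    -- the sampled sum
    have hsumN : Tendsto (fun N : ℕ => ∑ k ∈ Finset.range N, Real.pi * 𝓕 q k) atTop
        (𝓝 (∫ x, Complex.exp ((Real.pi * x : ℝ) * Complex.I) * 𝓕 q x * g x)) := by
      have hz : ∀ k : ℤ, k ∉ Set.range ((↑) : ℕ → ℤ) → (-1) ^ k * 𝓕 q k * g k = 0 := by
        intro k hk'
        have : k < 0 := not_le.1 fun h => hk' ⟨k.toNat, Int.toNat_of_nonneg h⟩
        rw [hk, stepSamples, if_pos this, mul_zero]
      have h := ((Nat.cast_injective (R := ℤ)).hasSum_iff hz).2 hsamp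
      refine h.tendsto_sum_nat.congr fun N => Finset.sum_congr rfl fun k _ => ?_
      simp only [Function.comp_apply]
      rw [hk, stepSamples, if_neg (by omega)]
      -- The signs of the samples cancel those of the sampling formula, leaving the unsigned
      -- one-sided sum.
      have h1 : ((-1 : ℂ) ^ (k : ℤ)) * (-1) ^ (k : ℤ) = 1 := by
        rw [← mul_zpow]; simp
      push_cast
      linear_combination (𝓕 q k * Real.pi) * h1
    have hPint : Real.pi * P = ∫ x, Complex.exp ((Real.pi * x : ℝ) * Complex.I) * 𝓕 q x * g x := by
      refine tendsto_nhds_unique ?_ hsumN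
      simp_rw [← Finset.mul_sum]
      exact hlim.const_mul _
    -- the negative band does not contribute
    have hneg : ∫ x, Complex.exp ((Real.pi * x : ℝ) * Complex.I) *
        𝓕 (fun v => (negBand δ v : ℂ)) x * g x = 0 := by
      -- The factor `e^{iπx}` shifts frequencies by `-1/2`, pushing the negative band strictly below
      -- `-1/2`.
      have hsub := tsupport_comp_sub_right_subset (-(1 / 2))
        ((tsupport_ofReal_subset _).trans (tsupport_negBand_subset hδ hδ'))
      have h := hspec _ (hasCompactSupport_of_tsupport_subset_Icc hsub)
        ((contDiff_ofReal_comp (contDiff_negBand δ)).comp (contDiff_id.sub contDiff_const))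
        (Set.disjoint_left.2 fun v hv hv' => by
          have := (hsub hv).2
          linarith [hv'.1])
      rw [← h]
      refine integral_congr_ae (Eventually.of_forall fun x => ?_)
      simp only
      rw [fourier_comp_sub_right (fun v => (negBand δ v : ℂ))]
      congr 3
      push_cast
      ring
    have hqc : HasCompactSupport q := hasCompactSupport_of_tsupport_subset_Icc hsupp
    have hnc : HasCompactSupport fun v => (negBand δ v : ℂ) :=
      hasCompactSupport_of_tsupport_subset_Icc
        ((tsupport_ofReal_subset _).trans (tsupport_negBand_subset hδ hδ'))
    have hbc : HasCompactSupport fun v => (bandPass δ v : ℂ) :=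
      hasCompactSupport_of_tsupport_subset_Icc
        ((tsupport_ofReal_subset _).trans (tsupport_bandPass_subset hδ hδ'))
    have hF : ∀ x, 𝓕 (fun v => (negBand δ v : ℂ)) x =
        𝓕 (fun v => (bandPass δ v : ℂ)) x - 𝓕 q x := by
      intro x
      rw [← fourier_sub_apply
        ((contDiff_ofReal_comp (contDiff_bandPass δ)).continuous.integrable_of_hasCompactSupport hbc)
        (hs.continuous.integrable_of_hasCompactSupport hqc)]
      simp only [negBand, Complex.ofReal_sub, q]
    have hmulint : ∀ {φ : ℝ → ℂ}, Integrable φ →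
        Integrable fun x => Complex.exp ((Real.pi * x : ℝ) * Complex.I) * φ x * g x := by
      intro φ hφ
      refine (hφ.bdd_mul (c := 1) (by fun_prop) (Eventually.of_forall fun x => ?_)).mul_bdd (c := M)
        hg.aestronglyMeasurable (Eventually.of_forall hM)
      rw [Complex.norm_exp_ofReal_mul_I]
    obtain ⟨hbi, hbn⟩ := integral_norm_fourier_bandPass_le hδ
    have hband : Real.pi * P = ∫ x, Complex.exp ((Real.pi * x : ℝ) * Complex.I) *
        𝓕 (fun v => (bandPass δ v : ℂ)) x * g x := by
      rw [hPint, ← sub_eq_zero, ← neg_eq_zero, neg_sub, ← integral_sub (hmulint hbi)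
        (hmulint (integrable_fourier_of_contDiff hqc hs)), ← hneg]
      refine integral_congr_ae (Eventually.of_forall fun x => ?_)
      simp only
      rw [hF]
      ring
    have hup : Real.pi * ‖P‖ ≤ M * (2 * lowPassNorm) := by
      have h1 : Real.pi * ‖P‖ = ‖(Real.pi : ℂ) * P‖ := by
        rw [norm_mul, Complex.norm_real, Real.norm_of_nonneg Real.pi_pos.le]
      rw [h1, hband]
      calc _ ≤ ∫ x, M * ‖𝓕 (fun v => (bandPass δ v : ℂ)) x‖ := by
            refine norm_integral_le_of_norm_le (hbi.norm.const_mul M)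
              (Eventually.of_forall fun x => ?_)
            rw [norm_mul, norm_mul, Complex.norm_exp_ofReal_mul_I, one_mul, mul_comm]
            exact mul_le_mul_of_nonneg_right (hM x) (norm_nonneg _)
        _ ≤ _ := by
            rw [integral_const_mul]
            exact mul_le_mul_of_nonneg_left hbn hM0
    -- The cotangent part, which carries the logarithm, is isolated as the imaginary part.
    have him : ∀ v : ℝ, ((posBand δ v : ℂ) * (1 / 2 - Real.cos (Real.pi * v) /
        (2 * Real.sin (Real.pi * v)) * Complex.I)).im =
        -(posBand δ v * (Real.cos (Real.pi * v) / (2 * Real.sin (Real.pi * v)))) := by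
      intro v
      have h1 : (posBand δ v : ℂ) * (1 / 2 - Real.cos (Real.pi * v) /
          (2 * Real.sin (Real.pi * v)) * Complex.I) = ((posBand δ v / 2 : ℝ) : ℂ) +
          ((-(posBand δ v * (Real.cos (Real.pi * v) / (2 * Real.sin (Real.pi * v)))) : ℝ) : ℂ) *
            Complex.I := by
        push_cast
        ring
      rw [h1]
      simp only [Complex.add_im, Complex.ofReal_im, Complex.im_ofReal_mul, Complex.I_im]
      ring
    have hre : Integrable fun v : ℝ => posBand δ v *
        (Real.cos (Real.pi * v) / (2 * Real.sin (Real.pi * v))) := by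
      have h := hpi.im.neg
      refine h.congr (Eventually.of_forall fun v => ?_)
      have h2 := him v
      simp only [Pi.neg_apply, RCLike.im_to_complex]
      linarith
    have hlow := log_le_integral_posBand_cot hδ hδ' hre
    have hPle : ∫ v, posBand δ v * (Real.cos (Real.pi * v) / (2 * Real.sin (Real.pi * v))) ≤ ‖P‖ := by
      have h2 : P.im = -∫ v, posBand δ v *
          (Real.cos (Real.pi * v) / (2 * Real.sin (Real.pi * v))) := by
        rw [← integral_neg]
        simp_rw [← him]
        exact (integral_im hpi).symm
      linarith [(neg_le_abs P.im).trans (Complex.abs_im_le_norm P)]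
    have hπ := Real.pi_pos
    have h1 := hlow.trans hPle
    rw [div_le_iff₀ (by positivity)] at h1
    linarith
  have hL : 0 ≤ M * lowPassNorm := mul_nonneg hM0 (integral_nonneg fun x => norm_nonneg _)
  -- This `δ` makes `log(1/(2δ))` equal to `8 M · lowPassNorm + 1`, one more than `key` allows.
  have h := key (Real.exp (-(8 * (M * lowPassNorm) + 1)) / 2) (by positivity)
    (by
      have : Real.exp (-(8 * (M * lowPassNorm) + 1)) ≤ 1 := Real.exp_le_one_iff.2 (by linarith)
      linarith)
  rw [show 2 * (Real.exp (-(8 * (M * lowPassNorm) + 1)) / 2) =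
    Real.exp (-(8 * (M * lowPassNorm) + 1)) by ring, one_div, ← Real.exp_neg, neg_neg,
    Real.log_exp] at h
  linarith

end

theorem mainTheorem6 :
    -- `G₁` is `sin(πz) ψ(-z)` away from the poles of `ψ(-z)`
    (∀ z : ℂ, (∀ n : ℕ, z ≠ n) →
      G₁ z = Complex.sin (Real.pi * z) * Complex.digamma (-z)) ∧
    -- `G₁ ∈ PW_1^+`
    G₁ ∈ PaleyWienerPlus 1 ∧
    -- `G₁ ∉ PW_1^∞`
    (¬ ∃ f ∈ PaleyWiener 1 ⊤, f =ᵐ[volume] fun t : ℝ => G₁ t) ∧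
    -- the integer samples of `G₁`
    (∀ k : ℤ, G₁ k = stepSamples k) ∧
    -- with any extra sample, the bandlimited interpolation is `G₁(z) + c sin(πz)`
    (∀ x : ℝ, (∀ k : ℤ, x ≠ k) → ∀ a' : ℂ, ∃ c : ℂ,
      IsBandlimitedInterp stepSamples x a' fun z => G₁ z + c * Complex.sin (Real.pi * z)) ∧
    -- no element of `PW_1^∞` (through its continuous representative) has these samples
    (¬ ∃ f ∈ PaleyWiener 1 ⊤, ∃ g : ℝ → ℂ, Continuous g ∧ f =ᵐ[volume] g ∧
      ∀ k : ℤ, g k = stepSamples k) ∧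
    -- the averages of `|G₁|` grow at least logarithmically, already on the negative half-line
    (∃ C : ℝ, 0 < C ∧ ∀ᶠ r : ℝ in atTop, C * Real.log r ≤ 1 / r * ∫ t in (-r)..0, ‖G₁ t‖) ∧
    -- the averages over `[-r, r]` are unbounded
    ¬ BddAbove ((fun r : ℝ => 1 / (2 * r) * ∫ t in (-r)..r, ‖G₁ t‖) '' Set.Ioi 0) := by
  rw [G₁_eq_sinDigamma]
  have hc : Continuous fun t : ℝ => sinDigamma t :=
    differentiable_sinDigamma.continuous.comp Complex.continuous_ofReal
  have hno : ¬ ∃ f ∈ PaleyWiener 1 ⊤, ∃ g : ℝ → ℂ, Continuous g ∧ f =ᵐ[volume] g ∧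
      ∀ k : ℤ, g k = stepSamples k := by
    rintro ⟨f, hf, g, hg, hfg, hk⟩
    obtain ⟨M, hM0, hM⟩ := exists_norm_le_of_ae_eq_Lp_top hg hfg
    exact not_exists_step_interpolant hg hM0 hM (hasSpectrumIn_of_mem_paleyWiener hf hfg) hk
  refine ⟨fun z hz => sinDigamma_eq_sin_mul_digamma hz, sinDigamma_mem_paleyWienerPlus, ?_,
    sinDigamma_intCast, fun x hx a' => exists_isBandlimitedInterp hx a', hno,
    exists_log_le_average, not_bddAbove_average⟩
  -- Membership of `G₁` itself would make its restriction to `ℝ` a forbidden interpolant.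
  rintro ⟨f, hf, hfg⟩
  exact hno ⟨f, hf, _, hc, hfg, fun k => by simpa using sinDigamma_intCast k⟩
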